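/- Let $\mathcal P=\{(a,b)\in\mathbb R^2 : a\le 0\le b,\ b-a\ge 1,\ -ab\le 1\}$ with the topology induced from $\mathbb R^2$, let $\bar{\mathbb R}=\mathbb R\cup\{\infty\}$, and let $T(x)=x+1$, $S(x)=-1/x$ on $\bar{\mathbb R}$ (so $S(0)=\infty$, $S(\infty)=0$, $T(\infty)=\infty$). For $(a,b)\in\mathcal P$ let $f=f_{a,b}:\bar{\mathbb R}\to\bar{\mathbb R}$ be the map with $f(x)=Tx$ if $x<a$, $f(x)=Sx$ if $a\le x<b$, $f(x)=T^{-1}x$ if $x\ge b$, and $f(\infty)=T^{-1}\infty=\infty$. The upper orbits of $a$ and $b$ are the forward orbits of $Sa$ and of $T^{-1}b$, respectively, under $f$. The lower orbits of $a$ and $b$ are the forward orbits of $Ta$ and of $Sb$, respectively, under the map that agrees with $f$ except that at the point $a$ it applies $T$ and at the point $b$ (if $b$ is hit) it applies $S$. In both cases $f^n(x)$ denotes the $n$-th point of the orbit that starts at $x$, and $f^n$ also denotes the product of the $n$ generators $T^{\pm1},S$ applied along it, regarded as a fractional linear transformation. The point $a$ has the strong cycle property if there are integers $m_1,k_1\ge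 0$ such that $f^{m_1}(Sa)=f^{k_1}(Ta)$, where the upper orbit points with indices $0,\dots,m_1$ and the lower orbit points with indices $0,\dots,k_1$ have no other coincidence (the cycle ends where the two orbits first meet), and the product over the cycle is the identity transformation: $T^{-1}f^{-k_1}f^{m_1}S=\mathrm{Id}$. Similarly, $b$ has the strong cycle property if there are $m_2,k_2\ge 0$ such that $f^{k_2}(Sb)=f^{m_2}(T^{-1}b)$, where the points with indices $0,\dots,k_2$ and $0,\dots,m_2$ of these two orbits have no other coincidence, and $Tf^{-m_2}f^{k_2}S=\mathrm{Id}$. **Proposition.** The set of parameters $(a,b)\in\mathcal P$ for which both $a$ and $b$ have the strong cycle property is open and dense in $\mathcal P$. -/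

import Mathlib

open scoped MatrixGroups OnePoint

noncomputable section

namespace ABContinuedFraction

/-- The parameter set `𝒫 = {(a,b) : a ≤ 0 ≤ b, b - a ≥ 1, -ab ≤ 1}`. -/
def parameterSet : Set (ℝ × ℝ) :=
  {p | p.1 ≤ 0 ∧ 0 ≤ p.2 ∧ 1 ≤ p.2 - p.1 ∧ -(p.1 * p.2) ≤ 1}

/-- The generator `T`, acting on `ℝ ∪ {∞}` by `x ↦ x + 1`. -/
def T : SL(2, ℤ) := ModularGroup.T

/-- The generator `S`, acting on `ℝ ∪ {∞}` by `x ↦ -1/x`. -/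
def S : SL(2, ℤ) := ModularGroup.S

/-- The action of `SL(2, ℤ)` on `ℝ ∪ {∞}` by fractional linear transformations. -/
def act (g : SL(2, ℤ)) (x : OnePoint ℝ) : OnePoint ℝ :=
  Matrix.SpecialLinearGroup.mapGL ℝ g • x

/-- The generator that the map `f_{a,b}` applies at a point: `T` on `x < a`, `S` on `a ≤ x < b`,
`T⁻¹` on `x ≥ b` (and at `∞`, which is fixed by `f_{a,b}`). Upper orbits use this rule also at
the discontinuity points: at `a` apply `S`, at `b` apply `T⁻¹`. -/
def rhoUpper (a b : ℝ) (x : OnePoint ℝ) : SL(2, ℤ) :=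
  x.elim T⁻¹ (fun t : ℝ => if t < a then T else if t < b then S else T⁻¹)

/-- The rule for lower orbits: the same as `rhoUpper` away from the discontinuity points `a`, `b`;
at `a` apply `T`, at `b` apply `S`. -/
def rhoLower (a b : ℝ) (x : OnePoint ℝ) : SL(2, ℤ) :=
  x.elim T⁻¹ (fun t : ℝ => if t ≤ a then T else if t ≤ b then S else T⁻¹)

/-- One step of the map that applies the generator `ρ x` at `x`. For `ρ = rhoUpper a b` this is
`f_{a,b}`. -/
def step (ρ : OnePoint ℝ → SL(2, ℤ)) (x : OnePoint ℝ) : OnePoint ℝ :=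
  act (ρ x) x

/-- The `n`-th point of the orbit of `x`. -/
def orbit (ρ : OnePoint ℝ → SL(2, ℤ)) (x : OnePoint ℝ) (n : ℕ) : OnePoint ℝ :=
  (step ρ)^[n] x

/-- The product of the generators applied in the first `n` steps of the orbit of `x`, i.e. `fⁿ`
regarded as an element of the modular group. -/
def word (ρ : OnePoint ℝ → SL(2, ℤ)) (x : OnePoint ℝ) : ℕ → SL(2, ℤ)
  | 0 => 1
  | n + 1 => ρ (orbit ρ x n) * word ρ x n

/-- `g` acts on `ℝ ∪ {∞}` as the identity transformation. -/
def IsIdentity (g : SL(2, ℤ)) : Prop := ∀ x : OnePoint ℝ, act g x = x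

/-- The sequences `u` and `l` meet at the indices `m`, `k`, and `u₀, …, uₘ` and `l₀, …, lₖ` have
no other coincidence: the cycle ends where the two orbits first meet. -/
def IsFirstMeeting (u l : ℕ → OnePoint ℝ) (m k : ℕ) : Prop :=
  u m = l k ∧ ∀ i ≤ m, ∀ j ≤ k, u i = l j → i = m ∧ j = k

/-- The point `a` has the strong cycle property: its upper orbit `fⁿ(Sa)` and its lower orbit
`fⁿ(Ta)` meet, and the product `T⁻¹ f⁻ᵏ fᵐ S` over the cycle is the identity transformation. -/
def StrongCycleA (a b : ℝ) : Prop :=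
  ∃ m k : ℕ,
    IsFirstMeeting (orbit (rhoUpper a b) (act S a)) (orbit (rhoLower a b) (act T a)) m k ∧
    IsIdentity (T⁻¹ * (word (rhoLower a b) (act T a) k)⁻¹ * word (rhoUpper a b) (act S a) m * S)

/-- The point `b` has the strong cycle property: its upper orbit `fⁿ(T⁻¹b)` and its lower orbit
`fⁿ(Sb)` meet, and the product `T f⁻ᵐ fᵏ S` over the cycle is the identity transformation. -/
def StrongCycleB (a b : ℝ) : Prop :=
  ∃ m k : ℕ,
    IsFirstMeeting (orbit (rhoUpper a b) (act T⁻¹ b)) (orbit (rhoLower a b) (act S b)) m k ∧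
    IsIdentity (T * (word (rhoUpper a b) (act T⁻¹ b) m)⁻¹ * word (rhoLower a b) (act S b) k * S)

end ABContinuedFraction

end

/-!
The reflection `x ↦ -x` exchanges the cycles of `a` and of `b` (`strongCycleA_iff_strongCycleB`), so
it suffices to show that the set of parameters for which `b` has the strong cycle property is open
and dense; an intersection of two open dense sets is again open and dense.

The orbits of `b` are compared at synchronized pairs (`IsSync`), at which the lower point is `x` and
the upper point is `x / (1 - x)`. The first such `x` is `1 - 1/b`. If `x ≤ a`, the next
synchronized lower point is `x + 1`; if `x ≥ b / (b + 1)`, it is `2 - 1/x`; if `x ≠ 0` lies in the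
gap `(a, b / (b + 1))` between these cases, the orbits meet at once, and the product over the cycle
is the identity, by the relation `(ST)³ = 1` (`IsSync.meet_of_neg`,
`IsSync.meet_of_pos`).

*Density* (`exists_strongCycleB`). If `b` is transcendental, then any meeting of its orbits has the
identity as product over the cycle, because no other modular transformation fixes `b`. If the
orbits met for no transcendental `b` in some interval, then for fixed `a < 0` the synchronized
points would avoid the gap for all `b` in this interval, so they would depend continuously on `b`
with a common itinerary. The map `x ↦ 2 - 1/x` expands by a factor of at least
`1 / (a + 1) ^ 2 > 1`, and it is applied infinitely often; this contradicts the boundedness of the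
synchronized points.

*Openness* (`eventually_strongCycleB`). Along a first meeting the points of each orbit are distinct,
so that neither orbit hits `b` or `∞` before the end. The words of the two orbits are therefore
locally constant in the parameters, unless one of the orbits hits `a`. As long as synchronized
points stay outside the gap, the upper orbit can hit `a` only at its start, where `b - 1 ≥ a` keeps
the rule unchanged, and the lower orbit only at a synchronized point. Under a perturbation, such a
point either stays on the same side, or it enters the gap and the orbits meet right there. A
remaining possibility is that the given first meeting lies beyond the meeting in the gap on one of
the two orbits; if that orbit hits `a` there, then the meeting in the gap is itself a first meeting
(`IsFirstMeeting.of_lt_of_lt`), and it is stable.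
-/

namespace ABContinuedFraction

/-! ### The action of the modular group on the projective line -/

theorem act_mul (g h : SL(2, ℤ)) (x : OnePoint ℝ) : act (g * h) x = act g (act h x) := by
  simp [act, mul_smul]

theorem act_one (x : OnePoint ℝ) : act 1 x = x := by
  simp [act]

theorem act_inv_act (g : SL(2, ℤ)) (x : OnePoint ℝ) : act g⁻¹ (act g x) = x := by
  rw [← act_mul, inv_mul_cancel, act_one]

theorem act_act_inv (g : SL(2, ℤ)) (x : OnePoint ℝ) : act g (act g⁻¹ x) = x := by
  rw [← act_mul, mul_inv_cancel, act_one]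

theorem act_injective (g : SL(2, ℤ)) : Function.Injective (act g) := fun x y h => by
  rw [← act_inv_act g x, h, act_inv_act]

theorem act_coe (g : SL(2, ℤ)) (x : ℝ) : act g (x : OnePoint ℝ) =
    if (g 1 0 : ℝ) * x + g 1 1 = 0 then ∞
      else (((g 0 0 * x + g 0 1) / (g 1 0 * x + g 1 1) : ℝ) : OnePoint ℝ) := by
  rw [act, OnePoint.smul_some_eq_ite]
  simp

theorem act_infty (g : SL(2, ℤ)) : act g ∞ =
    if (g 1 0 : ℝ) = 0 then ∞ else ((g 0 0 / g 1 0 : ℝ) : OnePoint ℝ) := by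
  rw [act, OnePoint.smul_infty_eq_ite]
  simp

theorem act_neg (g : SL(2, ℤ)) (x : OnePoint ℝ) : act (-g) x = act g x := by
  induction x using OnePoint.rec with
  | infty => simp [act_infty, neg_div_neg_eq]
  | coe x =>
    have h1 : -((g 1 0 : ℤ) : ℝ) * x + -((g 1 1 : ℤ) : ℝ) = -(g 1 0 * x + g 1 1) := by ring
    have h0 : -((g 0 0 : ℤ) : ℝ) * x + -((g 0 1 : ℤ) : ℝ) = -(g 0 0 * x + g 0 1) := by ring
    simp only [act_coe, Matrix.SpecialLinearGroup.coe_neg, Matrix.neg_apply, Int.cast_neg, h1, h0,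
      neg_eq_zero, neg_div_neg_eq]

@[simp] theorem act_T_coe (x : ℝ) : act T (x : OnePoint ℝ) = ((x + 1 : ℝ) : OnePoint ℝ) := by
  simp [act_coe, T, ModularGroup.coe_T]

@[simp] theorem act_T_infty : act T ∞ = ∞ := by
  simp [act_infty, T, ModularGroup.coe_T]

@[simp] theorem act_T_inv_coe (x : ℝ) :
    act T⁻¹ (x : OnePoint ℝ) = ((x - 1 : ℝ) : OnePoint ℝ) := by
  apply act_injective T
  rw [act_act_inv, act_T_coe, sub_add_cancel]

@[simp] theorem act_T_inv_infty : act T⁻¹ ∞ = ∞ := by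
  apply act_injective T
  rw [act_act_inv, act_T_infty]

@[simp] theorem act_S_infty : act S ∞ = ((0 : ℝ) : OnePoint ℝ) := by
  simp [act_infty, S, ModularGroup.coe_S]

@[simp] theorem act_S_zero : act S ((0 : ℝ) : OnePoint ℝ) = ∞ := by
  simp [act_coe, S, ModularGroup.coe_S]

theorem act_S_coe {x : ℝ} (hx : x ≠ 0) :
    act S (x : OnePoint ℝ) = ((-x⁻¹ : ℝ) : OnePoint ℝ) := by
  simp [act_coe, S, ModularGroup.coe_S, hx, neg_div]

theorem act_S_S (x : OnePoint ℝ) : act S (act S x) = x := by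
  rw [← act_mul, show S * S = -1 by decide, act_neg, act_one]

theorem act_STSTS (x : OnePoint ℝ) :
    act S (act T (act S (act T (act S x)))) = act T⁻¹ x := by
  simp only [← act_mul]
  rw [show S * (T * (S * (T * S))) = -T⁻¹ by decide, act_neg]

theorem act_STST (x : OnePoint ℝ) :
    act S (act T (act S (act T x))) = act T⁻¹ (act S x) := by
  rw [← act_STSTS, act_S_S]

/-- A modular transformation fixing a transcendental point is the identity transformation: its
fixed point equation is a quadratic equation with integer coefficients. -/
theorem isIdentity_of_act_transcendental {g : SL(2, ℤ)} {x : ℝ} (hx : Transcendental ℤ x)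
    (h : act g (x : OnePoint ℝ) = x) : IsIdentity g := by
  have hq : (g 1 0 : ℝ) * x ^ 2 + (g 1 1 - g 0 0 : ℤ) * x + (-g 0 1 : ℤ) = 0 := by
    rw [act_coe] at h
    split_ifs at h with h0
    · simp at h
    · have h := OnePoint.coe_injective h
      rw [div_eq_iff h0] at h
      push_cast
      linarith
  have hp : (Polynomial.C (g 1 0) * Polynomial.X ^ 2 + Polynomial.C (g 1 1 - g 0 0) * Polynomial.X
      + Polynomial.C (-g 0 1) : Polynomial ℤ) = 0 := by
    by_contra hne
    refine hx ⟨_, hne, ?_⟩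
    simpa using hq
  have h2 : g 1 0 = 0 := by
    simpa [Polynomial.coeff_X, Polynomial.coeff_C, -eq_intCast, -map_sub, -map_neg]
      using congrArg (fun p => p.coeff 2) hp
  have h1 : g 1 1 - g 0 0 = 0 := by
    simpa [Polynomial.coeff_X, Polynomial.coeff_C, -eq_intCast, -map_sub, -map_neg]
      using congrArg (fun p => p.coeff 1) hp
  have h0 : g 0 1 = 0 := by
    simpa [Polynomial.coeff_X, Polynomial.coeff_C, -eq_intCast, -map_sub, -map_neg]
      using congrArg (fun p => p.coeff 0) hp
  have hd := g.det_coe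
  rw [Matrix.det_fin_two, h2, h0, sub_eq_zero.1 h1] at hd
  have hne : (g 0 0 : ℝ) ≠ 0 := by
    intro h
    have h : g 0 0 = 0 := by exact_mod_cast h
    simp [h] at hd
  intro z
  induction z using OnePoint.rec with
  | infty => simp [act_infty, h2]
  | coe z => simp [act_coe, h2, h0, sub_eq_zero.1 h1, hne]

/-! ### Orbits and their words -/

theorem orbit_succ (ρ : OnePoint ℝ → SL(2, ℤ)) (x : OnePoint ℝ) (n : ℕ) :
    orbit ρ x (n + 1) = step ρ (orbit ρ x n) :=
  Function.iterate_succ_apply' _ _ _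

theorem orbit_eq_act_word (ρ : OnePoint ℝ → SL(2, ℤ)) (x : OnePoint ℝ) (n : ℕ) :
    orbit ρ x n = act (word ρ x n) x := by
  induction n with
  | zero => exact (act_one x).symm
  | succ n ih =>
    rw [orbit_succ, step, word, act_mul, ← ih]

@[simp] theorem rhoUpper_coe (a b x : ℝ) :
    rhoUpper a b (x : OnePoint ℝ) = if x < a then T else if x < b then S else T⁻¹ := rfl

@[simp] theorem rhoLower_coe (a b x : ℝ) :
    rhoLower a b (x : OnePoint ℝ) = if x ≤ a then T else if x ≤ b then S else T⁻¹ := rfl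

theorem step_rhoUpper_infty (a b : ℝ) : step (rhoUpper a b) ∞ = ∞ := act_T_inv_infty

theorem step_rhoLower_infty (a b : ℝ) : step (rhoLower a b) ∞ = ∞ := act_T_inv_infty

theorem step_rhoUpper_eq_step_rhoLower {a b : ℝ} {z : OnePoint ℝ} (ha : z ≠ a) (hb : z ≠ b) :
    step (rhoUpper a b) z = step (rhoLower a b) z := by
  induction z using OnePoint.rec with
  | infty => rfl
  | coe x =>
    have ha : x ≠ a := fun h => ha (by rw [h])
    have hb : x ≠ b := fun h => hb (by rw [h])
    simp only [step, rhoUpper_coe, rhoLower_coe, le_iff_lt_or_eq, ha, hb, or_false]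

/-- The upper orbit of the discontinuity point `b`. -/
noncomputable def upper (a b : ℝ) : ℕ → OnePoint ℝ := orbit (rhoUpper a b) (act T⁻¹ b)

/-- The lower orbit of the discontinuity point `b`. -/
noncomputable def lower (a b : ℝ) : ℕ → OnePoint ℝ := orbit (rhoLower a b) (act S b)

/-- The transformation that takes `b` to the `n`-th point of its upper orbit. -/
noncomputable def upperWord (a b : ℝ) (n : ℕ) : SL(2, ℤ) := word (rhoUpper a b) (act T⁻¹ b) n * T⁻¹

/-- The transformation that takes `b` to the `n`-th point of its lower orbit. -/
noncomputable def lowerWord (a b : ℝ) (n : ℕ) : SL(2, ℤ) := word (rhoLower a b) (act S b) n * S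

variable {a b : ℝ}

theorem upper_succ (n : ℕ) : upper a b (n + 1) = step (rhoUpper a b) (upper a b n) :=
  orbit_succ _ _ _

theorem lower_succ (n : ℕ) : lower a b (n + 1) = step (rhoLower a b) (lower a b n) :=
  orbit_succ _ _ _

theorem upper_eq_act (a b : ℝ) (n : ℕ) : upper a b n = act (upperWord a b n) b := by
  rw [upperWord, act_mul, ← orbit_eq_act_word, upper]

theorem lower_eq_act (a b : ℝ) (n : ℕ) : lower a b n = act (lowerWord a b n) b := by
  rw [lowerWord, act_mul, ← orbit_eq_act_word, lower]

theorem upperWord_zero (a b : ℝ) : upperWord a b 0 = T⁻¹ := one_mul _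

theorem lowerWord_zero (a b : ℝ) : lowerWord a b 0 = S := one_mul _

theorem upperWord_succ (a b : ℝ) (n : ℕ) :
    upperWord a b (n + 1) = rhoUpper a b (upper a b n) * upperWord a b n :=
  mul_assoc _ _ _

theorem lowerWord_succ (a b : ℝ) (n : ℕ) :
    lowerWord a b (n + 1) = rhoLower a b (lower a b n) * lowerWord a b n :=
  mul_assoc _ _ _

theorem strongCycleB_iff : StrongCycleB a b ↔ ∃ m k, IsFirstMeeting (upper a b) (lower a b) m k ∧
    ∀ z, act (upperWord a b m) z = act (lowerWord a b k) z := by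
  refine exists_congr fun m => exists_congr fun k => and_congr_right fun _ => ?_
  have h : T * (word (rhoUpper a b) (act T⁻¹ b) m)⁻¹ * word (rhoLower a b) (act S b) k * S =
      (upperWord a b m)⁻¹ * lowerWord a b k := by
    simp only [upperWord, lowerWord]
    group
  rw [h]
  refine forall_congr' fun z => ?_
  rw [act_mul]
  constructor <;> intro h
  · apply act_injective (upperWord a b m)⁻¹
    rw [h, act_inv_act]
  · rw [← h, act_inv_act]

section Steps

variable {n : ℕ} {x : ℝ}

theorem upperWord_step_S (h : upper a b n = x) (h1 : a ≤ x) (h2 : x < b) :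
    upperWord a b (n + 1) = S * upperWord a b n := by
  rw [upperWord_succ, h, rhoUpper_coe, if_neg h1.not_gt, if_pos h2]

theorem upperWord_step_T_inv (h : upper a b n = x) (h1 : a ≤ x) (h2 : b ≤ x) :
    upperWord a b (n + 1) = T⁻¹ * upperWord a b n := by
  rw [upperWord_succ, h, rhoUpper_coe, if_neg h1.not_gt, if_neg h2.not_gt]

theorem lowerWord_step_T (h : lower a b n = x) (h1 : x ≤ a) :
    lowerWord a b (n + 1) = T * lowerWord a b n := by
  rw [lowerWord_succ, h, rhoLower_coe, if_pos h1]

theorem lowerWord_step_S (h : lower a b n = x) (h1 : a < x) (h2 : x ≤ b) :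
    lowerWord a b (n + 1) = S * lowerWord a b n := by
  rw [lowerWord_succ, h, rhoLower_coe, if_neg h1.not_ge, if_pos h2]

theorem upper_step_S (h : upper a b n = x) (h1 : a ≤ x) (h2 : x < b) (h0 : x ≠ 0) :
    upper a b (n + 1) = ((-x⁻¹ : ℝ) : OnePoint ℝ) := by
  rw [upper_eq_act, upperWord_step_S h h1 h2, act_mul, ← upper_eq_act, h, act_S_coe h0]

theorem upper_step_T_inv (h : upper a b n = x) (h1 : a ≤ x) (h2 : b ≤ x) :
    upper a b (n + 1) = ((x - 1 : ℝ) : OnePoint ℝ) := by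
  rw [upper_eq_act, upperWord_step_T_inv h h1 h2, act_mul, ← upper_eq_act, h, act_T_inv_coe]

theorem lower_step_T (h : lower a b n = x) (h1 : x ≤ a) :
    lower a b (n + 1) = ((x + 1 : ℝ) : OnePoint ℝ) := by
  rw [lower_eq_act, lowerWord_step_T h h1, act_mul, ← lower_eq_act, h, act_T_coe]

theorem lower_step_S (h : lower a b n = x) (h1 : a < x) (h2 : x ≤ b) (h0 : x ≠ 0) :
    lower a b (n + 1) = ((-x⁻¹ : ℝ) : OnePoint ℝ) := by
  rw [lower_eq_act, lowerWord_step_S h h1 h2, act_mul, ← lower_eq_act, h, act_S_coe h0]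

end Steps

/-! ### First meetings of two orbits -/

section FirstMeeting

variable {u l : ℕ → OnePoint ℝ} {φ ψ : OnePoint ℝ → OnePoint ℝ} {m k : ℕ}

theorem IsFirstMeeting.symm (h : IsFirstMeeting u l m k) : IsFirstMeeting l u k m :=
  ⟨h.1.symm, fun j hj i hi e => (h.2 i hi j hj e.symm).symm⟩

theorem eq_add_of_eq (hu : ∀ n, u (n + 1) = φ (u n)) {i j : ℕ} (h : u i = u j) (t : ℕ) :
    u (i + t) = u (j + t) := by
  induction t with
  | zero => exact h
  | succ t ih => rw [← add_assoc, ← add_assoc, hu, hu, ih]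

/-- Up to a first meeting, the points of an orbit are distinct: a repetition would bring the meeting
forward. -/
theorem IsFirstMeeting.left_injOn (h : IsFirstMeeting u l m k) (hu : ∀ n, u (n + 1) = φ (u n))
    {i j : ℕ} (hij : i < j) (hj : j ≤ m) : u i ≠ u j := by
  intro e
  have e := eq_add_of_eq hu e (m - j)
  rw [Nat.add_sub_cancel' hj, h.1] at e
  have := (h.2 _ (by omega) k le_rfl e).1
  omega

theorem IsFirstMeeting.right_injOn (h : IsFirstMeeting u l m k) (hl : ∀ n, l (n + 1) = ψ (l n))
    {i j : ℕ} (hij : i < j) (hj : j ≤ k) : l i ≠ l j :=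
  h.symm.left_injOn hl hij hj

/-- If two sequences meet, they have a first meeting: one with minimal sum of the indices. -/
theorem exists_isFirstMeeting (h : u m = l k) : ∃ m k, IsFirstMeeting u l m k := by
  classical
  have hex : ∃ s, ∃ i j, i + j = s ∧ u i = l j := ⟨_, m, k, rfl, h⟩
  obtain ⟨i, j, hs, e⟩ := Nat.find_spec hex
  refine ⟨i, j, e, fun i' hi j' hj e' => ?_⟩
  have := Nat.find_min' hex ⟨i', j', rfl, e'⟩
  omega

/-- Let two orbits follow maps that agree outside a set `Z`, let them meet at the indices `M`, `K`
after having been apart, and let the second one avoid `Z` on the way. If they also have a first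
meeting with indices `m > M` and `k < K`, then the meeting at `M`, `K` is a first meeting as
well: from an earlier coincidence the first orbit would be led around a loop of the second one,
and `u 0, …, u m` would not be distinct, or `l (K - 1)` would recur. -/
theorem IsFirstMeeting.of_lt_of_lt {Z : Set (OnePoint ℝ)} (hφψ : ∀ z ∉ Z, φ z = ψ z)
    (hu : ∀ n, u (n + 1) = φ (u n)) (hl : ∀ n, l (n + 1) = ψ (l n)) {M K : ℕ}
    (hMK : u M = l K) (hlast : u (M - 1) ≠ l (K - 1)) (hlK : ∀ j < K - 1, l j ≠ l (K - 1))
    (hZ : ∀ j, 1 ≤ j → j < K → l j ∉ Z) (h : IsFirstMeeting u l m k) (hm : M < m) (hk : k < K) :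
    IsFirstMeeting u l M K := by
  refine ⟨hMK, fun s hs t ht e => ?_⟩
  by_contra hne
  have hkt : k < t := by
    by_contra hkt
    have := (h.2 s (by omega) t (by omega) e).1
    omega
  have follow : ∀ r, t + r ≤ K → u (s + r) = l (t + r) := by
    intro r
    induction r with
    | zero => intro _; exact e
    | succ r ih =>
      intro hr
      have e := ih (by omega)
      rw [← add_assoc, ← add_assoc, hu, hl, e, hφψ _ (hZ _ (by omega) (by omega))]
  have hd : u (s + (K - t)) = u M := by
    rw [follow _ (by omega), hMK, Nat.add_sub_cancel' ht]
  rcases lt_trichotomy (s + (K - t)) M with h1 | h1 | h1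
  · exact h.left_injOn hu h1 hm.le hd
  · have := follow (K - t - 1) (by omega)
    rw [show s + (K - t - 1) = M - 1 by omega, show t + (K - t - 1) = K - 1 by omega] at this
    exact hlast this
  · rcases le_or_gt (s + (K - t)) m with h2 | h2
    · exact h.left_injOn hu h1 h2 hd.symm
    · have e1 := follow (m - s) (by omega)
      rw [Nat.add_sub_cancel' (by omega), h.1] at e1
      have e2 := eq_add_of_eq hl e1 (K - 1 - (t + (m - s)))
      rw [show t + (m - s) + (K - 1 - (t + (m - s))) = K - 1 by omega] at e2
      exact hlK _ (by omega) e2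

end FirstMeeting

theorem IsFirstMeeting.upper_ne_infty {l : ℕ → OnePoint ℝ} {m k i : ℕ}
    (h : IsFirstMeeting (upper a b) l m k) (hi : i < m) : upper a b i ≠ ∞ := fun e =>
  h.left_injOn upper_succ (Nat.lt_succ_self i) hi (by rw [upper_succ, e, step_rhoUpper_infty])

theorem IsFirstMeeting.lower_ne_infty {u : ℕ → OnePoint ℝ} {m k j : ℕ}
    (h : IsFirstMeeting u (lower a b) m k) (hj : j < k) : lower a b j ≠ ∞ := fun e =>
  h.right_injOn lower_succ (Nat.lt_succ_self j) hj (by rw [lower_succ, e, step_rhoLower_infty])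

/-- An upper orbit that hits `b` returns to its start. -/
theorem upper_succ_of_eq (hab : a ≤ b) {i : ℕ} (h : upper a b i = b) :
    upper a b (i + 1) = upper a b 0 := by
  rw [upper_eq_act, upperWord_step_T_inv h hab le_rfl, act_mul, ← upper_eq_act, h, upper_eq_act,
    upperWord_zero]

/-- A lower orbit that hits `b` returns to its start. -/
theorem lower_succ_of_eq (hab : a < b) {i : ℕ} (h : lower a b i = b) :
    lower a b (i + 1) = lower a b 0 := by
  rw [lower_eq_act, lowerWord_step_S h hab le_rfl, act_mul, ← lower_eq_act, h, lower_eq_act,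
    lowerWord_zero]

/-- For a transcendental `b`, any meeting of the two orbits of `b` gives the strong cycle property:
the product over the cycle fixes `b`. -/
theorem strongCycleB_of_transcendental (hb : Transcendental ℤ b) {m k : ℕ}
    (h : upper a b m = lower a b k) : StrongCycleB a b := by
  obtain ⟨m, k, h⟩ := exists_isFirstMeeting h
  refine strongCycleB_iff.2 ⟨m, k, h, fun z => ?_⟩
  have hid : IsIdentity ((upperWord a b m)⁻¹ * lowerWord a b k) := by
    refine isIdentity_of_act_transcendental hb ?_
    rw [act_mul, ← lower_eq_act, ← h.1, upper_eq_act, act_inv_act]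
  conv_lhs => rw [← hid z, act_mul, act_act_inv]

/-! ### Synchronized points of the two orbits -/

/-- The `p`-th point of the upper orbit of `b` and the `q`-th point `x` of its lower orbit are
synchronized: `x` lies in `[1 - 1/b, a + 1]`, the upper point is `x / (1 - x)`, written here as
`1 / (1 - x) - 1`, and this relation also holds between the transformations that take `b` to the
two points. -/
structure IsSync (a b x : ℝ) (p q : ℕ) : Prop where
  upper_eq : upper a b p = (((1 - x)⁻¹ - 1 : ℝ) : OnePoint ℝ)
  lower_eq : lower a b q = (x : OnePoint ℝ)
  le : 1 - b⁻¹ ≤ x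
  le_add_one : x ≤ a + 1
  lt_one : x < 1
  word_eq : ∀ z, act (lowerWord a b q) z = act T (act S (act T (act (upperWord a b p) z)))

theorem neg_inv_le_of_mem (hP : (a, b) ∈ parameterSet) (hb : 0 < b) : -b⁻¹ ≤ a := by
  obtain ⟨h1, h2, h3, h4⟩ := hP
  simp only at h1 h2 h3 h4
  have : -b⁻¹ = -1 / b := by rw [neg_div, one_div]
  rw [this, div_le_iff₀ hb]
  linarith

theorem lt_of_mem (hP : (a, b) ∈ parameterSet) : a < b := by
  have : 1 ≤ b - a := hP.2.2.1
  linarith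

theorem upper_zero (a b : ℝ) : upper a b 0 = ((b - 1 : ℝ) : OnePoint ℝ) := act_T_inv_coe b

theorem lower_zero (a : ℝ) (hb : 0 < b) : lower a b 0 = ((-b⁻¹ : ℝ) : OnePoint ℝ) :=
  act_S_coe hb.ne'

theorem IsSync.init (hP : (a, b) ∈ parameterSet) (hb : 0 < b) : IsSync a b (1 - b⁻¹) 0 1 where
  upper_eq := by rw [upper_zero]; simp
  lower_eq := by
    rw [lower_step_T (lower_zero a hb) (neg_inv_le_of_mem hP hb), neg_add_eq_sub]
  le := le_rfl
  le_add_one := by linarith [neg_inv_le_of_mem hP hb]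
  lt_one := by linarith [inv_pos.2 hb]
  word_eq z := by
    rw [lowerWord_step_T (lower_zero a hb) (neg_inv_le_of_mem hP hb), lowerWord_zero,
      upperWord_zero, act_act_inv, act_mul]

namespace IsSync

variable {x : ℝ} {p q : ℕ}

theorem sub_one_le_upper (h : IsSync a b x p q) (hb : 0 < b) : b - 1 ≤ (1 - x)⁻¹ - 1 := by
  have h1 : b ≤ (1 - x)⁻¹ := by
    rw [le_inv_comm₀ hb (by linarith [h.lt_one])]
    linarith [h.le]
  linarith

theorem neg_inv_upper (h : IsSync a b x p q) (hx : x ≠ 0) : -((1 - x)⁻¹ - 1)⁻¹ = 1 - x⁻¹ := by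
  have h1 : 1 - x ≠ 0 := by linarith [h.lt_one]
  have h2 : (1 - x)⁻¹ - 1 = x / (1 - x) := by field_simp; ring
  rw [h2, inv_div]
  field_simp
  ring

theorem upper_pos (h : IsSync a b x p q) (hx : 0 < x) : 0 < (1 - x)⁻¹ - 1 := by
  have := (one_lt_inv₀ (by linarith [h.lt_one] : 0 < 1 - x)).2 (by linarith)
  linarith

theorem upper_neg (_h : IsSync a b x p q) (hx : x < 0) : (1 - x)⁻¹ - 1 < 0 := by
  have := inv_lt_one_of_one_lt₀ (by linarith : 1 < 1 - x)
  linarith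

theorem upper_lt_iff (h : IsSync a b x p q) (hb : 0 < b) :
    (1 - x)⁻¹ - 1 < b ↔ x < b / (b + 1) := by
  rw [sub_lt_iff_lt_add, inv_lt_comm₀ (by linarith [h.lt_one]) (by linarith),
    show b / (b + 1) = 1 - (b + 1)⁻¹ by field_simp; ring]
  constructor <;> intro <;> linarith

theorem lower_le (h : IsSync a b x p q) (hP : (a, b) ∈ parameterSet) : x ≤ b := by
  have : 1 ≤ b - a := hP.2.2.1
  linarith [h.le_add_one]

theorem neg_inv_le (h : IsSync a b x p q) (hP : (a, b) ∈ parameterSet) (hb : 0 < b) (hx : 0 < x) :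
    -x⁻¹ ≤ a := by
  have := inv_anti₀ hx (h.lower_le hP)
  linarith [neg_inv_le_of_mem hP hb]

theorem le_neg_inv (h : IsSync a b x p q) (hb : 0 < b) (hx : x < 0) : b ≤ -x⁻¹ := by
  rw [← inv_neg, le_inv_comm₀ hb (by linarith)]
  linarith [h.le]

theorem le_one_sub_inv (h : IsSync a b x p q) (hb : 0 < b) (hx : x < 0) : b ≤ 1 - x⁻¹ := by
  linarith [h.le_neg_inv hb hx]

theorem one_sub_inv_le (h : IsSync a b x p q) (hP : (a, b) ∈ parameterSet) (hx : 0 < x) :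
    1 - x⁻¹ ≤ a := by
  have h1 : a ≤ 0 := hP.1
  have h2 := h.le_add_one
  have h3 : 1 - a ≤ x⁻¹ := by
    rw [le_inv_comm₀ (by linarith) hx]
    refine h2.trans ?_
    rw [← one_div, le_div_iff₀ (by linarith)]
    nlinarith
  linarith

theorem le_upper (h : IsSync a b x p q) (hP : (a, b) ∈ parameterSet) (hb : 0 < b) :
    a ≤ (1 - x)⁻¹ - 1 := by
  have : 1 ≤ b - a := hP.2.2.1
  linarith [h.sub_one_le_upper hb]

theorem upper_add_one_of_neg (h : IsSync a b x p q) (hP : (a, b) ∈ parameterSet) (hb : 0 < b)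
    (hx : x < 0) : upper a b (p + 1) = ((1 - x⁻¹ : ℝ) : OnePoint ℝ) := by
  rw [upper_step_S h.upper_eq (h.le_upper hP hb) ((h.upper_neg hx).trans hb) (h.upper_neg hx).ne,
    h.neg_inv_upper hx.ne]

theorem upper_add_two_of_neg (h : IsSync a b x p q) (hP : (a, b) ∈ parameterSet) (hb : 0 < b)
    (hx : x < 0) : upper a b (p + 2) = ((-x⁻¹ : ℝ) : OnePoint ℝ) := by
  rw [upper_step_T_inv (h.upper_add_one_of_neg hP hb hx)
    ((lt_of_mem hP).le.trans (h.le_one_sub_inv hb hx)) (h.le_one_sub_inv hb hx)]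
  congr 1
  ring

theorem upperWord_add_two_of_neg (h : IsSync a b x p q) (hP : (a, b) ∈ parameterSet) (hb : 0 < b)
    (hx : x < 0) : upperWord a b (p + 2) = T⁻¹ * S * upperWord a b p := by
  rw [upperWord_step_T_inv (h.upper_add_one_of_neg hP hb hx)
    ((lt_of_mem hP).le.trans (h.le_one_sub_inv hb hx)) (h.le_one_sub_inv hb hx),
    upperWord_step_S h.upper_eq (h.le_upper hP hb) ((h.upper_neg hx).trans hb), mul_assoc]

theorem lower_add_one_of_pos (h : IsSync a b x p q) (hP : (a, b) ∈ parameterSet) (hx : 0 < x) :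
    lower a b (q + 1) = ((-x⁻¹ : ℝ) : OnePoint ℝ) :=
  lower_step_S h.lower_eq (lt_of_le_of_lt hP.1 hx) (h.lower_le hP) hx.ne'

theorem lower_add_two_of_pos (h : IsSync a b x p q) (hP : (a, b) ∈ parameterSet) (hb : 0 < b)
    (hx : 0 < x) : lower a b (q + 2) = ((1 - x⁻¹ : ℝ) : OnePoint ℝ) := by
  rw [lower_step_T (h.lower_add_one_of_pos hP hx) (h.neg_inv_le hP hb hx), neg_add_eq_sub]

theorem lowerWord_add_two_of_pos (h : IsSync a b x p q) (hP : (a, b) ∈ parameterSet) (hb : 0 < b)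
    (hx : 0 < x) : lowerWord a b (q + 2) = T * S * lowerWord a b q := by
  rw [lowerWord_step_T (h.lower_add_one_of_pos hP hx) (h.neg_inv_le hP hb hx),
    lowerWord_step_S h.lower_eq (lt_of_le_of_lt hP.1 hx) (h.lower_le hP), mul_assoc]

/-- Below `a` the lower point moves to `x + 1`, while the upper point moves in three steps. -/
theorem next_of_le (h : IsSync a b x p q) (hP : (a, b) ∈ parameterSet) (hb : 0 < b) (hx : x < 0)
    (hxa : x ≤ a) : IsSync a b (x + 1) (p + 3) (q + 1) where
  upper_eq := by
    rw [upper_step_T_inv (h.upper_add_two_of_neg hP hb hx)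
      ((lt_of_mem hP).le.trans (h.le_neg_inv hb hx)) (h.le_neg_inv hb hx), sub_add_cancel_right,
      inv_neg]
  lower_eq := lower_step_T h.lower_eq hxa
  le := by linarith [h.le]
  le_add_one := by linarith
  lt_one := by linarith
  word_eq z := by
    rw [upperWord_step_T_inv (h.upper_add_two_of_neg hP hb hx)
      ((lt_of_mem hP).le.trans (h.le_neg_inv hb hx)) (h.le_neg_inv hb hx),
      h.upperWord_add_two_of_neg hP hb hx, lowerWord_step_T h.lower_eq hxa]
    simp only [act_mul]
    rw [h.word_eq, act_act_inv, ← act_STST, act_S_S]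

/-- From `b / (b + 1)` on, the upper point is at least `b` and moves to the left by `1`, while the
lower point moves to `2 - 1 / x` in three steps. -/
theorem next_of_ge (h : IsSync a b x p q) (hP : (a, b) ∈ parameterSet) (hb : 0 < b)
    (hxb : b / (b + 1) ≤ x) : IsSync a b (2 - x⁻¹) (p + 1) (q + 3) := by
  have hx : 0 < x := lt_of_lt_of_le (by positivity) hxb
  have hy : b ≤ (1 - x)⁻¹ - 1 := by
    rw [← not_lt, h.upper_lt_iff hb]
    exact hxb.not_gt
  have hx1 := h.lt_one
  have hinv : 1 < x⁻¹ := (one_lt_inv₀ hx).2 hx1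
  have e1 := h.lower_add_two_of_pos hP hb hx
  have e2 := h.one_sub_inv_le hP hx
  refine ⟨?_, ?_, ?_, ?_, ?_, fun z => ?_⟩
  · rw [upper_step_T_inv h.upper_eq (h.le_upper hP hb) hy]
    congr 1
    have : 1 - x ≠ 0 := by linarith
    have : x - 1 ≠ 0 := by linarith
    have : 1 - (2 - x⁻¹) = (1 - x) / x := by field_simp; ring
    rw [this, inv_div]
    field_simp
    ring
  · rw [lower_step_T e1 e2]
    congr 1
    ring
  · have : x⁻¹ ≤ (b / (b + 1))⁻¹ := inv_anti₀ (by positivity) hxb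
    have h3 : (b / (b + 1))⁻¹ = 1 + b⁻¹ := by field_simp
    linarith
  · linarith
  · linarith
  · rw [upperWord_step_T_inv h.upper_eq (h.le_upper hP hb) hy, lowerWord_step_T e1 e2,
      h.lowerWord_add_two_of_pos hP hb hx]
    simp only [act_mul]
    rw [h.word_eq, act_act_inv, act_STST, act_act_inv]

/-- In the gap between `a` and `0` the lower point is moved by `S`, and the orbits meet. -/
theorem meet_of_neg (h : IsSync a b x p q) (hP : (a, b) ∈ parameterSet) (hb : 0 < b) (hx : x < 0)
    (hax : a < x) : lower a b (q + 1) = ((-x⁻¹ : ℝ) : OnePoint ℝ) ∧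
      ∀ z, act (upperWord a b (p + 2)) z = act (lowerWord a b (q + 1)) z := by
  refine ⟨lower_step_S h.lower_eq hax (h.lower_le hP) hx.ne, fun z => ?_⟩
  rw [h.upperWord_add_two_of_neg hP hb hx, lowerWord_step_S h.lower_eq hax (h.lower_le hP)]
  simp only [act_mul]
  rw [h.word_eq, act_STST]

/-- In the gap between `0` and `b / (b + 1)` the upper point is moved by `S`, and the orbits
meet. -/
theorem meet_of_pos (h : IsSync a b x p q) (hP : (a, b) ∈ parameterSet) (hb : 0 < b) (hx : 0 < x)
    (hxb : x < b / (b + 1)) : upper a b (p + 1) = ((1 - x⁻¹ : ℝ) : OnePoint ℝ) ∧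
      ∀ z, act (upperWord a b (p + 1)) z = act (lowerWord a b (q + 2)) z := by
  have hy := (h.upper_lt_iff hb).2 hxb
  refine ⟨by rw [upper_step_S h.upper_eq (h.le_upper hP hb) hy (h.upper_pos hx).ne',
    h.neg_inv_upper hx.ne'], fun z => ?_⟩
  rw [upperWord_step_S h.upper_eq (h.le_upper hP hb) hy, h.lowerWord_add_two_of_pos hP hb hx]
  simp only [act_mul]
  rw [h.word_eq, act_STST, act_act_inv]

end IsSync

/-- The lower points `x₀ = 1 - 1/b`, `x₁`, … of the successive synchronized pairs. -/
noncomputable def syncPoint (a b : ℝ) : ℕ → ℝ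
  | 0 => 1 - b⁻¹
  | n + 1 => if syncPoint a b n ≤ a then syncPoint a b n + 1 else 2 - (syncPoint a b n)⁻¹

/-- The indices of the synchronized points on the upper and on the lower orbit. -/
noncomputable def syncIndex (a b : ℝ) : ℕ → ℕ × ℕ
  | 0 => (0, 1)
  | n + 1 => if syncPoint a b n ≤ a then ((syncIndex a b n).1 + 3, (syncIndex a b n).2 + 1)
      else ((syncIndex a b n).1 + 1, (syncIndex a b n).2 + 3)

/-- The first `n` synchronized points lie outside the gap `(a, b / (b + 1))` and differ from `0`,
so that the orbits go on without meeting there. -/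
def IsOutside (a b : ℝ) (n : ℕ) : Prop :=
  ∀ i < n, (syncPoint a b i ≤ a ∧ syncPoint a b i < 0) ∨ b / (b + 1) ≤ syncPoint a b i

theorem syncPoint_succ_of_le {n : ℕ} (h : syncPoint a b n ≤ a) :
    syncPoint a b (n + 1) = syncPoint a b n + 1 := if_pos h

theorem syncPoint_succ_of_lt {n : ℕ} (h : a < syncPoint a b n) :
    syncPoint a b (n + 1) = 2 - (syncPoint a b n)⁻¹ := if_neg h.not_ge

theorem syncIndex_succ_of_le {n : ℕ} (h : syncPoint a b n ≤ a) :
    syncIndex a b (n + 1) = ((syncIndex a b n).1 + 3, (syncIndex a b n).2 + 1) := if_pos h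

theorem syncIndex_succ_of_lt {n : ℕ} (h : a < syncPoint a b n) :
    syncIndex a b (n + 1) = ((syncIndex a b n).1 + 1, (syncIndex a b n).2 + 3) := if_neg h.not_ge

theorem IsOutside.mono {m n : ℕ} (h : IsOutside a b n) (hmn : m ≤ n) : IsOutside a b m :=
  fun i hi => h i (hi.trans_le hmn)

theorem isOutside_zero (a b : ℝ) : IsOutside a b 0 := fun i hi => absurd hi i.not_lt_zero

theorem isOutside_succ {n : ℕ} : IsOutside a b (n + 1) ↔ IsOutside a b n ∧
    ((syncPoint a b n ≤ a ∧ syncPoint a b n < 0) ∨ b / (b + 1) ≤ syncPoint a b n) := by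
  constructor
  · exact fun h => ⟨h.mono n.le_succ, h n n.lt_succ_self⟩
  · rintro ⟨h1, h2⟩ i hi
    rcases Nat.lt_succ_iff_lt_or_eq.1 hi with h | rfl
    exacts [h1 i h, h2]

theorem lt_of_div_le {x : ℝ} (ha : a ≤ 0) (hb : 0 < b) (h : b / (b + 1) ≤ x) : a < x :=
  ha.trans_lt (lt_of_lt_of_le (by positivity) h)

theorem IsOutside.isSync (hP : (a, b) ∈ parameterSet) (hb : 0 < b) {n : ℕ}
    (h : IsOutside a b n) :
    IsSync a b (syncPoint a b n) (syncIndex a b n).1 (syncIndex a b n).2 := by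
  induction n with
  | zero => exact IsSync.init hP hb
  | succ n ih =>
    obtain ⟨h1, h2⟩ := isOutside_succ.1 h
    rcases h2 with ⟨h2, h0⟩ | h2
    · rw [syncPoint_succ_of_le h2, syncIndex_succ_of_le h2]
      exact (ih h1).next_of_le hP hb h0 h2
    · have h3 := lt_of_div_le hP.1 hb h2
      rw [syncPoint_succ_of_lt h3, syncIndex_succ_of_lt h3]
      exact (ih h1).next_of_ge hP hb h2

/-- If the orbits do not meet at the first synchronized pair, then `a < 0`. -/
theorem IsOutside.neg (hP : (a, b) ∈ parameterSet) (hb : 0 < b) {n : ℕ}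
    (h : IsOutside a b n) (hn : 0 < n) : a < 0 := by
  have h1 : 1 ≤ b - a := hP.2.2.1
  have hb1 : b < 1 := by
    rcases h 0 hn with ⟨_, h0⟩ | h0
    · rw [syncPoint, sub_neg] at h0
      exact (one_lt_inv₀ hb).1 h0
    · exfalso
      have h2 : 1 - b⁻¹ < b / (b + 1) := by
        have e : b / (b + 1) - (1 - b⁻¹) = (b * (b + 1))⁻¹ := by field_simp; ring
        have : 0 < (b * (b + 1))⁻¹ := by positivity
        linarith
      exact absurd h0 h2.not_ge
  linarith

theorem fst_syncIndex_lt (n : ℕ) : (syncIndex a b n).1 < (syncIndex a b (n + 1)).1 := by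
  rcases le_or_gt (syncPoint a b n) a with h | h
  · rw [syncIndex_succ_of_le h]; simp
  · rw [syncIndex_succ_of_lt h]; simp

theorem snd_syncIndex_lt (n : ℕ) : (syncIndex a b n).2 < (syncIndex a b (n + 1)).2 := by
  rcases le_or_gt (syncPoint a b n) a with h | h
  · rw [syncIndex_succ_of_le h]; simp
  · rw [syncIndex_succ_of_lt h]; simp

theorem strictMono_fst_syncIndex : StrictMono fun n => (syncIndex a b n).1 :=
  strictMono_nat_of_lt_succ fst_syncIndex_lt

theorem strictMono_snd_syncIndex : StrictMono fun n => (syncIndex a b n).2 :=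
  strictMono_nat_of_lt_succ snd_syncIndex_lt

theorem snd_syncIndex_pos (n : ℕ) : 0 < (syncIndex a b n).2 :=
  lt_of_lt_of_le Nat.one_pos (strictMono_snd_syncIndex.monotone n.zero_le)

theorem fst_syncIndex_add_two_lt {n N : ℕ} (h : syncPoint a b n ≤ a) (hn : n < N) :
    (syncIndex a b n).1 + 2 < (syncIndex a b N).1 := by
  have : (syncIndex a b (n + 1)).1 ≤ (syncIndex a b N).1 :=
    strictMono_fst_syncIndex.monotone (Nat.succ_le_of_lt hn)
  simp only [syncIndex_succ_of_le h] at this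
  omega

/-- Location of the upper orbit before the orbits meet. -/
theorem IsOutside.upper_mem (hP : (a, b) ∈ parameterSet) (hb : 0 < b) {n : ℕ}
    (h : IsOutside a b n) {i : ℕ} (hi : i < (syncIndex a b n).1) :
    ∃ r : ℝ, upper a b i = r ∧ r ≤ 1 - a⁻¹ ∧ (b ≤ r ∨ b - 1 ≤ r ∧ r ≤ (1 - a)⁻¹ - 1) := by
  induction n with
  | zero => exact absurd hi i.not_lt_zero
  | succ n ih =>
    have ha := h.neg hP hb n.succ_pos
    obtain ⟨h1, h2⟩ := isOutside_succ.1 h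
    have hs := h1.isSync hP hb
    rcases lt_or_ge i (syncIndex a b n).1 with h4 | h4
    · exact ih h1 h4
    have hinv : a⁻¹ < 0 := inv_neg''.2 ha
    have hle := hs.le_add_one
    have hlt := hs.lt_one
    rcases h2 with ⟨h2, h0⟩ | h2
    · rw [syncIndex_succ_of_le h2] at hi
      have hinv' : a⁻¹ ≤ (syncPoint a b n)⁻¹ := (inv_le_inv_of_neg ha h0).2 h2
      obtain rfl | rfl | rfl : i = (syncIndex a b n).1 ∨ i = (syncIndex a b n).1 + 1 ∨
        i = (syncIndex a b n).1 + 2 := by simp only at hi; omega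
      · refine ⟨_, hs.upper_eq, by linarith [hs.upper_neg h0], Or.inr ⟨hs.sub_one_le_upper hb, ?_⟩⟩
        have := inv_anti₀ (by linarith : 0 < 1 - a) (by linarith : 1 - a ≤ 1 - syncPoint a b n)
        linarith
      · exact ⟨_, hs.upper_add_one_of_neg hP hb h0, by linarith, Or.inl (hs.le_one_sub_inv hb h0)⟩
      · exact ⟨_, hs.upper_add_two_of_neg hP hb h0, by linarith, Or.inl (hs.le_neg_inv hb h0)⟩
    · have h3 := lt_of_div_le hP.1 hb h2
      rw [syncIndex_succ_of_lt h3] at hi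
      obtain rfl : i = (syncIndex a b n).1 := by simp only at hi; omega
      have h5 := inv_anti₀ (by linarith : 0 < -a) (by linarith : -a ≤ 1 - syncPoint a b n)
      rw [inv_neg] at h5
      refine ⟨_, hs.upper_eq, by linarith, Or.inl ?_⟩
      rw [← not_lt, hs.upper_lt_iff hb]
      exact h2.not_gt

/-- Location of the lower orbit before the orbits meet. After its first point, it can hit `a` only
at a synchronized point. -/
theorem IsOutside.lower_mem (hP : (a, b) ∈ parameterSet) (hb : 0 < b) {n : ℕ}
    (h : IsOutside a b n) {j : ℕ} (hj : j < (syncIndex a b n).2) :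
    ∃ r : ℝ, lower a b j = r ∧ -1 - b⁻¹ ≤ r ∧ (r ≤ a ∨ b / (b + 1) ≤ r ∧ r ≤ a + 1) ∧
      (r = a → j = 0 ∨ ∃ N < n, j = (syncIndex a b N).2 ∧ syncPoint a b N = a) := by
  have hinv : 0 < b⁻¹ := inv_pos.2 hb
  induction n with
  | zero =>
    obtain rfl : j = 0 := Nat.lt_one_iff.1 hj
    exact ⟨_, lower_zero a hb, by linarith, Or.inl (neg_inv_le_of_mem hP hb), fun _ => Or.inl rfl⟩
  | succ n ih =>
    have ha := h.neg hP hb n.succ_pos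
    obtain ⟨h1, h2⟩ := isOutside_succ.1 h
    have hs := h1.isSync hP hb
    rcases lt_or_ge j (syncIndex a b n).2 with h4 | h4
    · obtain ⟨r, hr, hr1, hr2, hr3⟩ := ih h1 h4
      refine ⟨r, hr, hr1, hr2, fun e => (hr3 e).imp_right ?_⟩
      rintro ⟨N, hN, e1⟩
      exact ⟨N, hN.trans n.lt_succ_self, e1⟩
    have hle := hs.le_add_one
    rcases h2 with ⟨h2, h0⟩ | h2
    · rw [syncIndex_succ_of_le h2] at hj
      obtain rfl : j = (syncIndex a b n).2 := by simp only at hj; omega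
      exact ⟨_, hs.lower_eq, by linarith [hs.le], Or.inl h2,
        fun e => Or.inr ⟨n, n.lt_succ_self, rfl, e⟩⟩
    · have h3 := lt_of_div_le hP.1 hb h2
      have hx : 0 < syncPoint a b n := lt_of_lt_of_le (by positivity) h2
      have hxinv : (syncPoint a b n)⁻¹ ≤ 1 + b⁻¹ := by
        have h6 := inv_anti₀ (by positivity) h2
        have h7 : (b / (b + 1))⁻¹ = 1 + b⁻¹ := by field_simp
        linarith
      have hxa : (a + 1)⁻¹ ≤ (syncPoint a b n)⁻¹ := inv_anti₀ hx hle
      -- The values `-1/x` and `1 - 1/x` lie strictly below `a`, as `1 / (a + 1) > 1 - a`.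
      have hstrict : 1 - a < (a + 1)⁻¹ := by
        rw [← one_div, lt_div_iff₀ (by linarith)]
        nlinarith [mul_pos (neg_pos.2 ha) (neg_pos.2 ha)]
      rw [syncIndex_succ_of_lt h3] at hj
      obtain rfl | rfl | rfl : j = (syncIndex a b n).2 ∨ j = (syncIndex a b n).2 + 1 ∨
        j = (syncIndex a b n).2 + 2 := by simp only at hj; omega
      · exact ⟨_, hs.lower_eq, by linarith [hs.le], Or.inr ⟨h2, hle⟩, fun e => absurd e h3.ne'⟩
      · exact ⟨_, hs.lower_add_one_of_pos hP hx, by linarith, Or.inl (by linarith),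
          fun e => by linarith⟩
      · exact ⟨_, hs.lower_add_two_of_pos hP hb hx, by linarith, Or.inl (by linarith),
          fun e => by linarith⟩

/-- Before the orbits meet, the upper orbit can be at `a` only if `a = b - 1` is its start. -/
theorem IsOutside.upper_eq_left (hP : (a, b) ∈ parameterSet) (hb : 0 < b) {n : ℕ}
    (h : IsOutside a b n) {i : ℕ} (hi : i < (syncIndex a b n).1) (hia : upper a b i = a) :
    upper a b i = upper a b 0 := by
  obtain ⟨r, hr, -, hr2⟩ := h.upper_mem hP hb hi
  have e : r = a := OnePoint.coe_injective (hr.symm.trans hia)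
  have h1 : 1 ≤ b - a := hP.2.2.1
  rw [hr, upper_zero]
  congr 1
  rcases hr2 with h2 | h2 <;> linarith [h2]

/-- Before they meet, the two orbits are disjoint if `b - a > 1`. -/
theorem IsOutside.upper_ne_lower (hP : (a, b) ∈ parameterSet) (hb : 0 < b) (hab : 1 < b - a)
    {n : ℕ} (h : IsOutside a b n) {i j : ℕ} (hi : i < (syncIndex a b n).1)
    (hj : j < (syncIndex a b n).2) : upper a b i ≠ lower a b j := by
  obtain ⟨r, hr, -, hr2⟩ := h.upper_mem hP hb hi
  obtain ⟨s, hs, -, hs2, -⟩ := h.lower_mem hP hb hj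
  rw [hr, hs]
  intro e
  obtain rfl : r = s := OnePoint.coe_injective e
  have ha : a ≤ 0 := hP.1
  have h0 : 0 < b / (b + 1) := by positivity
  have h1 : (1 - a)⁻¹ ≤ 1 := inv_le_one_of_one_le₀ (by linarith)
  rcases hr2 with h2 | h2 <;> rcases hs2 with h3 | h3 <;> linarith [h2, h3]

/-- In the gap, the synchronized upper point differs from all previous upper points. -/
theorem IsOutside.upper_ne_upper (hP : (a, b) ∈ parameterSet) (hb : 0 < b) {n : ℕ}
    (h : IsOutside a b n) (ha : a < syncPoint a b n) (hxb : syncPoint a b n < b / (b + 1))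
    {i : ℕ} (hi : i < (syncIndex a b n).1) :
    upper a b i ≠ upper a b (syncIndex a b n).1 := by
  obtain ⟨r, hr, -, hr2⟩ := h.upper_mem hP hb hi
  have hs := h.isSync hP hb
  rw [hr, hs.upper_eq]
  intro e
  have e := OnePoint.coe_injective e
  have h1 := (hs.upper_lt_iff hb).2 hxb
  have h2 : (1 - a)⁻¹ < (1 - syncPoint a b n)⁻¹ :=
    inv_strictAnti₀ (by linarith [hs.lt_one]) (by linarith)
  rcases hr2 with h2 | h2 <;> linarith [h2]

/-- In the gap, the synchronized lower point differs from all previous lower points. -/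
theorem IsOutside.lower_ne_lower (hP : (a, b) ∈ parameterSet) (hb : 0 < b) {n : ℕ}
    (h : IsOutside a b n) (ha : a < syncPoint a b n) (hxb : syncPoint a b n < b / (b + 1))
    {j : ℕ} (hj : j < (syncIndex a b n).2) :
    lower a b j ≠ lower a b (syncIndex a b n).2 := by
  obtain ⟨r, hr, -, hr2, -⟩ := h.lower_mem hP hb hj
  rw [hr, (h.isSync hP hb).lower_eq]
  intro e
  have e := OnePoint.coe_injective e
  rcases hr2 with h2 | h2 <;> linarith [h2]

theorem exists_gap_of_not_isOutside (ha : a ≤ 0) {n : ℕ} (h : ¬ IsOutside a b n) :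
    ∃ N < n, IsOutside a b N ∧ (syncPoint a b N = 0 ∨
      a < syncPoint a b N ∧ syncPoint a b N < b / (b + 1) ∧ syncPoint a b N ≠ 0) := by
  induction n with
  | zero => exact absurd (isOutside_zero a b) h
  | succ n ih =>
    by_cases hn : IsOutside a b n
    · rw [isOutside_succ, not_and] at h
      have h := h hn
      rw [not_or, not_and, not_le] at h
      refine ⟨n, n.lt_succ_self, hn, or_iff_not_imp_left.2 fun h0 => ⟨?_, h.2, h0⟩⟩
      by_contra hle
      exact h.1 (not_lt.1 hle) (lt_of_le_of_ne ((not_lt.1 hle).trans ha) h0)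
    · obtain ⟨N, hN, h⟩ := ih hn
      exact ⟨N, hN.trans n.lt_succ_self, h⟩

theorem IsOutside.upper_eq_zero (hP : (a, b) ∈ parameterSet) (hb : 0 < b) {n : ℕ}
    (h : IsOutside a b n) (h0 : syncPoint a b n = 0) :
    upper a b (syncIndex a b n).1 = ((0 : ℝ) : OnePoint ℝ) := by
  rw [(h.isSync hP hb).upper_eq, h0]
  simp

theorem IsOutside.lower_eq_zero (hP : (a, b) ∈ parameterSet) (hb : 0 < b) {n : ℕ}
    (h : IsOutside a b n) (h0 : syncPoint a b n = 0) :
    lower a b (syncIndex a b n).2 = ((0 : ℝ) : OnePoint ℝ) := by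
  rw [(h.isSync hP hb).lower_eq, h0]

theorem exists_upper_eq_lower (hP : (a, b) ∈ parameterSet) (hb : 0 < b) {n : ℕ}
    (h : ¬ IsOutside a b n) : ∃ m k, upper a b m = lower a b k := by
  obtain ⟨N, -, hN, h⟩ := exists_gap_of_not_isOutside hP.1 h
  have hs := hN.isSync hP hb
  rcases h with h0 | ⟨h1, h2, h0⟩
  · exact ⟨_, _, (hN.upper_eq_zero hP hb h0).trans (hN.lower_eq_zero hP hb h0).symm⟩
  · rcases lt_or_gt_of_ne h0 with h0 | h0
    · exact ⟨_, _, (hs.upper_add_two_of_neg hP hb h0).trans (hs.meet_of_neg hP hb h0 h1).1.symm⟩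
    · exact ⟨_, _, (hs.meet_of_pos hP hb h0 h2).1.trans (hs.lower_add_two_of_pos hP hb h0).symm⟩

/-! ### Density of the strong cycle property -/

section Interval

variable {b₁ b₂ : ℝ}

theorem dense_transcendental : Dense {x : ℝ | Transcendental ℤ x} :=
  (Algebraic.countable ℤ ℝ).dense_compl ℝ

/-- A relatively closed condition on `b` that holds at the transcendental points of an interval
holds on the whole interval. -/
theorem forall_Icc_of_transcendental (h12 : b₁ < b₂) {p : ℝ → Prop}
    (hp : ∀ b ∈ Set.Icc b₁ b₂, ¬ p b → ∀ᶠ c in nhdsWithin b (Set.Icc b₁ b₂), ¬ p c)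
    (h : ∀ b ∈ Set.Icc b₁ b₂, Transcendental ℤ b → p b) : ∀ b ∈ Set.Icc b₁ b₂, p b := by
  intro b hb
  by_contra hn
  have h1 : b ∈ closure (Set.Ioo b₁ b₂ ∩ {x : ℝ | Transcendental ℤ x}) :=
    closure_minimal (dense_transcendental.open_subset_closure_inter isOpen_Ioo) isClosed_closure
      (by rwa [closure_Ioo h12.ne])
  obtain ⟨c, ⟨hc1, hc2⟩, hc3⟩ :=
    ((mem_closure_iff_frequently.1 h1).and_eventually
      (eventually_nhdsWithin_iff.1 (hp b hb hn))).exists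
  exact hc3 (Set.Ioo_subset_Icc_self hc1) (h c (Set.Ioo_subset_Icc_self hc1) hc2)

/-- If the synchronized points avoid the gap for all transcendental `b` of an interval, then they
stay on one side of it as long as they depend continuously on `b`. -/
theorem syncPoint_le_or_le (ha : a < 0) (h12 : b₁ < b₂) (hb : ∀ b ∈ Set.Icc b₁ b₂, 0 < b)
    (h : ∀ b ∈ Set.Icc b₁ b₂, Transcendental ℤ b → ∀ n, IsOutside a b n) {n : ℕ}
    (hc : ContinuousOn (fun b => syncPoint a b n) (Set.Icc b₁ b₂)) :
    (∀ b ∈ Set.Icc b₁ b₂, syncPoint a b n ≤ a) ∨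
      ∀ b ∈ Set.Icc b₁ b₂, b / (b + 1) ≤ syncPoint a b n := by
  have hdiv : ContinuousOn (fun b : ℝ => b / (b + 1)) (Set.Icc b₁ b₂) :=
    continuousOn_id.div (continuousOn_id.add continuousOn_const)
      fun b hb' => (add_pos (hb b hb') one_pos).ne'
  have hout : ∀ b ∈ Set.Icc b₁ b₂, syncPoint a b n ≤ a ∨ b / (b + 1) ≤ syncPoint a b n := by
    refine forall_Icc_of_transcendental h12 (fun b hb' hn => ?_) fun b hb' ht => ?_
    · rw [not_or, not_le, not_le] at hn
      filter_upwards [(hc b hb').eventually (lt_mem_nhds hn.1),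
        (hc b hb').eventually_lt (hdiv b hb') hn.2] with c h1 h2
      rw [not_or, not_le, not_le]
      exact ⟨h1, h2⟩
    · exact (h b hb' ht (n + 1) n n.lt_succ_self).imp_left And.left
  by_contra hn
  simp only [not_or, not_forall] at hn
  obtain ⟨⟨c, hcI, hc1⟩, ⟨d, hdI, hd1⟩⟩ := hn
  have hc2 := (hout c hcI).resolve_left hc1
  have hd2 := (hout d hdI).resolve_right hd1
  have hcpos : 0 < c / (c + 1) := by have := hb c hcI; positivity
  obtain ⟨e, heI, he⟩ := isPreconnected_Icc.intermediate_value hdI hcI hc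
    (show a / 2 ∈ Set.Icc _ _ from ⟨by linarith, by linarith⟩)
  have hepos : 0 < e / (e + 1) := by have := hb e heI; positivity
  have he : syncPoint a e n = a / 2 := he
  rcases hout e heI with h1 | h1 <;> linarith

theorem continuousOn_syncPoint (ha : a < 0) (h12 : b₁ < b₂) (hb : ∀ b ∈ Set.Icc b₁ b₂, 0 < b)
    (h : ∀ b ∈ Set.Icc b₁ b₂, Transcendental ℤ b → ∀ n, IsOutside a b n) (n : ℕ) :
    ContinuousOn (fun b => syncPoint a b n) (Set.Icc b₁ b₂) := by
  induction n with
  | zero => exact continuousOn_const.sub (continuousOn_id.inv₀ fun b hb' => (hb b hb').ne')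
  | succ n ih =>
    rcases syncPoint_le_or_le ha h12 hb h ih with h1 | h1
    · exact (ih.add continuousOn_const).congr fun b hb' => syncPoint_succ_of_le (h1 b hb')
    · have hpos : ∀ b ∈ Set.Icc b₁ b₂, 0 < syncPoint a b n := fun b hb' =>
        lt_of_lt_of_le (by have := hb b hb'; positivity) (h1 b hb')
      exact (continuousOn_const.sub (ih.inv₀ fun b hb' => (hpos b hb').ne')).congr
        fun b hb' => syncPoint_succ_of_lt (ha.trans (hpos b hb'))

/-- In every interval of parameters `b`, the orbits of some transcendental `b` meet. Otherwise the
synchronized points of the two end points would always take the same branch, the distance between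
them would never decrease, and it would grow at least by the factor `1 / (a + 1) ^ 2` whenever the
branch `x ↦ 2 - 1 / x` is taken, which happens infinitely often; but the synchronized points are
bounded. -/
theorem exists_strongCycleB (ha : a < 0) (h12 : b₁ < b₂) (hb : ∀ b ∈ Set.Icc b₁ b₂, 0 < b)
    (hP : ∀ b ∈ Set.Icc b₁ b₂, (a, b) ∈ parameterSet) :
    ∃ b ∈ Set.Icc b₁ b₂, StrongCycleB a b := by
  by_contra hno
  have hout : ∀ b ∈ Set.Icc b₁ b₂, Transcendental ℤ b → ∀ n, IsOutside a b n := by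
    intro b hb' ht n
    by_contra hn
    obtain ⟨m, k, e⟩ := exists_upper_eq_lower (hP b hb') (hb b hb') hn
    exact hno ⟨b, hb', strongCycleB_of_transcendental ht e⟩
  have hbranch := fun n =>
    syncPoint_le_or_le ha h12 hb hout (continuousOn_syncPoint ha h12 hb hout n)
  have hI1 := Set.left_mem_Icc.2 h12.le
  have hI2 := Set.right_mem_Icc.2 h12.le
  have houtside : ∀ b ∈ Set.Icc b₁ b₂, ∀ n, IsOutside a b n := fun b hb' n i _ =>
    (hbranch i).imp (fun h => ⟨h b hb', (h b hb').trans_lt ha⟩) fun h => h b hb'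
  have hs1 := fun n => (houtside b₁ hI1 n).isSync (hP b₁ hI1) (hb b₁ hI1)
  have hs2 := fun n => (houtside b₂ hI2 n).isSync (hP b₂ hI2) (hb b₂ hI2)
  set D : ℕ → ℝ := fun n => syncPoint a b₂ n - syncPoint a b₁ n with hD
  have hD0 : 0 < D 0 := by
    have := inv_strictAnti₀ (hb b₁ hI1) h12
    simp only [hD, syncPoint]
    linarith
  have hle : ∀ n, (∀ b ∈ Set.Icc b₁ b₂, syncPoint a b n ≤ a) → D (n + 1) = D n := by
    intro n h
    simp only [hD, syncPoint_succ_of_le (h b₁ hI1), syncPoint_succ_of_le (h b₂ hI2)]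
    ring
  have hgt : ∀ n, 0 < D n → (∀ b ∈ Set.Icc b₁ b₂, b / (b + 1) ≤ syncPoint a b n) →
      0 < a + 1 ∧ ((a + 1) ^ 2)⁻¹ * D n ≤ D (n + 1) := by
    intro n hn h
    have p1 : 0 < syncPoint a b₁ n := lt_of_lt_of_le (by have := hb b₁ hI1; positivity) (h b₁ hI1)
    have p2 : 0 < syncPoint a b₂ n := lt_of_lt_of_le (by have := hb b₂ hI2; positivity) (h b₂ hI2)
    have q1 := (hs1 n).le_add_one
    have q2 := (hs2 n).le_add_one
    have e : D (n + 1) = (syncPoint a b₁ n * syncPoint a b₂ n)⁻¹ * D n := by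
      simp only [hD, syncPoint_succ_of_lt (ha.trans p1), syncPoint_succ_of_lt (ha.trans p2)]
      field_simp
      ring
    refine ⟨p1.trans_le q1, ?_⟩
    rw [e]
    refine mul_le_mul_of_nonneg_right (inv_anti₀ (mul_pos p1 p2) ?_) hn.le
    rw [sq]
    exact mul_le_mul q1 q2 p2.le (p1.le.trans q1)
  have hone : 0 < a + 1 → 1 < ((a + 1) ^ 2)⁻¹ := fun h =>
    (one_lt_inv₀ (by positivity)).2 (by nlinarith)
  have hpos : ∀ n, 0 < D n := by
    intro n
    induction n with
    | zero => exact hD0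
    | succ n ih =>
      rcases hbranch n with h | h
      · rwa [hle n h]
      · obtain ⟨h1, h2⟩ := hgt n ih h
        exact lt_of_lt_of_le (mul_pos (by positivity) ih) h2
  have hmono : Monotone D := by
    refine monotone_nat_of_le_succ fun n => ?_
    rcases hbranch n with h | h
    · exact (hle n h).ge
    · obtain ⟨h1, h2⟩ := hgt n (hpos n) h
      exact (le_mul_of_one_le_left (hpos n).le (hone h1).le).trans h2
  have hinf : ∀ n, ∃ m, n ≤ m ∧ ∀ b ∈ Set.Icc b₁ b₂, b / (b + 1) ≤ syncPoint a b m := by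
    intro n
    by_contra hn
    have h1 : ∀ m, n ≤ m → syncPoint a b₁ m ≤ a := fun m hm =>
      (hbranch m).resolve_right (fun h => hn ⟨m, hm, h⟩) b₁ hI1
    have h2 : ∀ i : ℕ, syncPoint a b₁ (n + i) = syncPoint a b₁ n + i := by
      intro i
      induction i with
      | zero => simp
      | succ i ih =>
        rw [← add_assoc, syncPoint_succ_of_le (h1 _ (by omega)), ih]
        push_cast
        ring
    obtain ⟨i, hi⟩ := exists_nat_gt (a - syncPoint a b₁ n)
    have := h1 (n + i) (by omega)
    rw [h2] at this
    linarith
  have ha1 : 0 < a + 1 := by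
    obtain ⟨m, -, h⟩ := hinf 0
    exact (hgt m (hpos m) h).1
  have hgrow : ∀ N : ℕ, ∃ n, ((a + 1) ^ 2)⁻¹ ^ N * D 0 ≤ D n := by
    intro N
    induction N with
    | zero => exact ⟨0, by simp⟩
    | succ N ih =>
      obtain ⟨n, hn⟩ := ih
      obtain ⟨m, hm, h⟩ := hinf n
      refine ⟨m + 1, le_trans ?_ (hgt m (hpos m) h).2⟩
      rw [pow_succ', mul_assoc]
      exact mul_le_mul_of_nonneg_left (hn.trans (hmono hm)) (by positivity)
  obtain ⟨N, hN⟩ := pow_unbounded_of_one_lt ((a + b₁⁻¹) / D 0) (hone ha1)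
  obtain ⟨n, hn⟩ := hgrow N
  rw [div_lt_iff₀ hD0] at hN
  have h1 := (hs1 n).le
  have h2 := (hs2 n).le_add_one
  have h3 : D n = syncPoint a b₂ n - syncPoint a b₁ n := rfl
  linarith

end Interval

/-! ### The corner at which the two orbits meet -/

/-- The orbits meet at the indices `M`, `K`, right after `N` synchronized pairs outside the gap,
with equal transformations. The remaining fields say that the orbits are apart just before, that
the points at `M - 1` and `K - 1` are new on their orbits, and where the discontinuities can be
hit. -/
structure IsCorner (a b : ℝ) (N M K : ℕ) : Prop where
  meet : upper a b M = lower a b K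
  word_eq : ∀ z, act (upperWord a b M) z = act (lowerWord a b K) z
  pos_left : 0 < M
  pos_right : 0 < K
  fst_lt : (syncIndex a b N).1 < M
  snd_lt : (syncIndex a b N).2 < K
  apart : upper a b (M - 1) ≠ lower a b (K - 1)
  upper_new : ∀ i < M - 1, upper a b i ≠ upper a b (M - 1)
  lower_new : ∀ j < K - 1, lower a b j ≠ lower a b (K - 1)
  upper_ne_right : upper a b (M - 1) ≠ b
  lower_ne_right : lower a b (K - 1) ≠ b
  upper_eq_left : ∀ i < M, upper a b i = a → upper a b i = upper a b 0
  lower_eq_left : ∀ j < K, lower a b j = a →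
    j = 0 ∨ ∃ n < N, j = (syncIndex a b n).2 ∧ syncPoint a b n = a

theorem IsOutside.lower_eq_left (hP : (a, b) ∈ parameterSet) (hb : 0 < b) {n : ℕ}
    (h : IsOutside a b n) {j : ℕ} (hj : j < (syncIndex a b n).2) (hja : lower a b j = a) :
    j = 0 ∨ ∃ N < n, j = (syncIndex a b N).2 ∧ syncPoint a b N = a := by
  obtain ⟨r, hr, -, -, hr3⟩ := h.lower_mem hP hb hj
  exact hr3 (OnePoint.coe_injective (hr.symm.trans hja))

theorem IsOutside.isCorner_of_neg (hP : (a, b) ∈ parameterSet) (hb : 0 < b) {N : ℕ}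
    (h : IsOutside a b N) (hx : syncPoint a b N < 0) (hax : a < syncPoint a b N) :
    IsCorner a b N ((syncIndex a b N).1 + 2) ((syncIndex a b N).2 + 1) := by
  have hs := h.isSync hP hb
  have hxb : syncPoint a b N < b / (b + 1) := hx.trans (by positivity)
  have ha : a < 0 := hax.trans hx
  have e0 := hs.upper_eq
  have e1 := hs.upper_add_one_of_neg hP hb hx
  have e2 := hs.upper_add_two_of_neg hP hb hx
  have f0 := hs.lower_eq
  obtain ⟨f1, hw⟩ := hs.meet_of_neg hP hb hx hax
  have hinv : (syncPoint a b N)⁻¹ < a⁻¹ := (inv_lt_inv_of_neg hx ha).2 hax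
  have hba := hs.le_one_sub_inv hb hx
  have hbx := hs.le_neg_inv hb hx
  have hle := hs.le_upper hP hb
  have hlt := hs.upper_neg hx
  have hax' : a < (1 - syncPoint a b N)⁻¹ - 1 := by
    have h1 : (1 - a)⁻¹ < (1 - syncPoint a b N)⁻¹ :=
      inv_strictAnti₀ (by linarith [hs.lt_one]) (by linarith)
    have h2 : a ≤ (1 - a)⁻¹ - 1 := by
      have : (1 + a) ≤ (1 - a)⁻¹ := by
        rw [← one_div, le_div_iff₀ (by linarith)]
        nlinarith
      linarith
    linarith
  refine ⟨e2.trans f1.symm, hw, by omega, by omega, by omega, by omega, ?_, ?_, ?_, ?_, ?_, ?_, ?_⟩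
  · rw [Nat.add_sub_cancel, show (syncIndex a b N).1 + 2 - 1 = (syncIndex a b N).1 + 1 by omega,
      e1, f0]
    intro e
    linarith [OnePoint.coe_injective e]
  · rw [show (syncIndex a b N).1 + 2 - 1 = (syncIndex a b N).1 + 1 by omega, e1]
    intro i hi
    rcases Nat.lt_succ_iff_lt_or_eq.1 hi with hi | rfl
    · obtain ⟨r, hr, hr1, -⟩ := h.upper_mem hP hb hi
      rw [hr]
      intro e
      linarith [OnePoint.coe_injective e]
    · rw [e0]
      intro e
      linarith [OnePoint.coe_injective e]
  · rw [Nat.add_sub_cancel]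
    exact fun j hj => h.lower_ne_lower hP hb hax hxb hj
  · rw [show (syncIndex a b N).1 + 2 - 1 = (syncIndex a b N).1 + 1 by omega, e1]
    intro e
    linarith [OnePoint.coe_injective e]
  · rw [Nat.add_sub_cancel, f0]
    intro e
    linarith [OnePoint.coe_injective e]
  · intro i hi e
    rcases lt_or_ge i (syncIndex a b N).1 with h1 | h1
    · exact h.upper_eq_left hP hb h1 e
    · exfalso
      obtain rfl | rfl : i = (syncIndex a b N).1 ∨ i = (syncIndex a b N).1 + 1 := by omega
      · rw [e0] at e
        exact hax'.ne' (OnePoint.coe_injective e)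
      · rw [e1] at e
        linarith [OnePoint.coe_injective e]
  · intro j hj e
    rcases Nat.lt_succ_iff_lt_or_eq.1 hj with hj | rfl
    · exact h.lower_eq_left hP hb hj e
    · rw [f0] at e
      exact absurd (OnePoint.coe_injective e) hax.ne'

theorem IsOutside.isCorner_of_pos (hP : (a, b) ∈ parameterSet) (hb : 0 < b) {N : ℕ}
    (h : IsOutside a b N) (hx : 0 < syncPoint a b N) (hxb : syncPoint a b N < b / (b + 1)) :
    IsCorner a b N ((syncIndex a b N).1 + 1) ((syncIndex a b N).2 + 2) := by
  have hs := h.isSync hP hb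
  have ha : a ≤ 0 := hP.1
  have hax : a < syncPoint a b N := ha.trans_lt hx
  have e0 := hs.upper_eq
  obtain ⟨e1, hw⟩ := hs.meet_of_pos hP hb hx hxb
  have f0 := hs.lower_eq
  have f1 := hs.lower_add_one_of_pos hP hx
  have f2 := hs.lower_add_two_of_pos hP hb hx
  have hinv : 1 + b⁻¹ < (syncPoint a b N)⁻¹ := by
    have h1 := inv_strictAnti₀ hx hxb
    have h2 : (b / (b + 1))⁻¹ = 1 + b⁻¹ := by field_simp
    linarith
  have hba := neg_inv_le_of_mem hP hb
  have hy := (hs.upper_lt_iff hb).2 hxb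
  have hy0 := hs.upper_pos hx
  refine ⟨e1.trans f2.symm, hw, by omega, by omega, by omega, by omega, ?_, ?_, ?_, ?_, ?_, ?_, ?_⟩
  · rw [Nat.add_sub_cancel, show (syncIndex a b N).2 + 2 - 1 = (syncIndex a b N).2 + 1 by omega,
      e0, f1]
    intro e
    linarith [OnePoint.coe_injective e]
  · rw [Nat.add_sub_cancel]
    exact fun i hi => h.upper_ne_upper hP hb hax hxb hi
  · rw [show (syncIndex a b N).2 + 2 - 1 = (syncIndex a b N).2 + 1 by omega, f1]
    intro j hj
    rcases Nat.lt_succ_iff_lt_or_eq.1 hj with hj | rfl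
    · obtain ⟨r, hr, hr1, -⟩ := h.lower_mem hP hb hj
      rw [hr]
      intro e
      linarith [OnePoint.coe_injective e]
    · rw [f0]
      intro e
      linarith [OnePoint.coe_injective e]
  · rw [Nat.add_sub_cancel, e0]
    exact fun e => hy.ne (OnePoint.coe_injective e)
  · rw [show (syncIndex a b N).2 + 2 - 1 = (syncIndex a b N).2 + 1 by omega, f1]
    intro e
    linarith [OnePoint.coe_injective e]
  · intro i hi e
    rcases Nat.lt_succ_iff_lt_or_eq.1 hi with hi | rfl
    · exact h.upper_eq_left hP hb hi e
    · rw [e0] at e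
      linarith [OnePoint.coe_injective e]
  · intro j hj e
    rcases lt_or_ge j (syncIndex a b N).2 with h1 | h1
    · exact h.lower_eq_left hP hb h1 e
    · exfalso
      obtain rfl | rfl : j = (syncIndex a b N).2 ∨ j = (syncIndex a b N).2 + 1 := by omega
      · rw [f0] at e
        exact hax.ne' (OnePoint.coe_injective e)
      · rw [f1] at e
        linarith [OnePoint.coe_injective e]

namespace IsCorner

variable {N M K : ℕ}

theorem upper_ne_zero_point (h : IsCorner a b N M K) {i : ℕ} (hi : 0 < i) (hiM : i < M) :
    upper a b i ≠ upper a b 0 := by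
  intro e
  have e := eq_add_of_eq upper_succ e (M - 1 - i)
  rw [show i + (M - 1 - i) = M - 1 by omega] at e
  exact h.upper_new _ (by omega) e.symm

theorem lower_ne_zero_point (h : IsCorner a b N M K) {j : ℕ} (hj : 0 < j) (hjK : j < K) :
    lower a b j ≠ lower a b 0 := by
  intro e
  have e := eq_add_of_eq lower_succ e (K - 1 - j)
  rw [show j + (K - 1 - j) = K - 1 by omega] at e
  exact h.lower_new _ (by omega) e.symm

theorem eq_zero_of_upper_eq_left (h : IsCorner a b N M K) {i : ℕ} (hi : i < M)
    (e : upper a b i = a) : i = 0 := by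
  by_contra h0
  exact h.upper_ne_zero_point (Nat.pos_of_ne_zero h0) hi (h.upper_eq_left i hi e)

theorem upper_ne (h : IsCorner a b N M K) (hab : a < b) {i : ℕ} (hi : i < M) :
    upper a b i ≠ b := by
  intro e
  rcases Nat.lt_or_ge (i + 1) M with h1 | h1
  · exact h.upper_ne_zero_point i.succ_pos h1 (upper_succ_of_eq hab.le e)
  · rw [show i = M - 1 by omega] at e
    exact h.upper_ne_right e

theorem lower_ne (h : IsCorner a b N M K) (hab : a < b) {j : ℕ} (hj : j < K) :
    lower a b j ≠ b := by
  intro e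
  rcases Nat.lt_or_ge (j + 1) K with h1 | h1
  · exact h.lower_ne_zero_point j.succ_pos h1 (lower_succ_of_eq hab e)
  · rw [show j = K - 1 by omega] at e
    exact h.lower_ne_right e

end IsCorner

/-! ### Stability of the orbits under perturbation -/

section Stability

variable {F : Filter (ℝ × ℝ)} {f : ℝ × ℝ → ℝ} {r : ℝ}

theorem exists_continuousAt_of_act_eq {g : SL(2, ℤ)} {x : ℝ} (h : act g x = (r : OnePoint ℝ)) :
    ∃ f : ℝ → ℝ, f x = r ∧ ContinuousAt f x ∧
      ∀ᶠ y : ℝ in nhds x, act g y = ((f y : ℝ) : OnePoint ℝ) := by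
  rw [act_coe] at h
  split_ifs at h with h0
  · simp at h
  have hc : ContinuousAt (fun y : ℝ => (g 1 0 : ℝ) * y + g 1 1) x := by fun_prop
  refine ⟨fun y => (g 0 0 * y + g 0 1) / (g 1 0 * y + g 1 1), OnePoint.coe_injective h,
    ContinuousAt.div (by fun_prop) hc h0, ?_⟩
  filter_upwards [hc.eventually_ne h0] with y hy
  rw [act_coe, if_neg hy]

theorem eventually_act_eq (hF : F ≤ nhds (a, b)) {g : SL(2, ℤ)}
    (h : act g b = (r : OnePoint ℝ)) : ∃ f : ℝ × ℝ → ℝ, Filter.Tendsto f F (nhds r) ∧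
      ∀ᶠ p in F, act g (p.2 : ℝ) = ((f p : ℝ) : OnePoint ℝ) := by
  obtain ⟨f, hf, hc, hev⟩ := exists_continuousAt_of_act_eq h
  have hsnd : Filter.Tendsto (fun p : ℝ × ℝ => p.2) F (nhds b) :=
    (continuous_snd.tendsto (a, b)).mono_left hF
  refine ⟨fun p => f p.2, ?_, hsnd.eventually hev⟩
  rw [← hf]
  exact Filter.Tendsto.comp hc hsnd

theorem eventually_act_ne_act (hF : F ≤ nhds (a, b)) {g h : SL(2, ℤ)} (hg : act g b ≠ ∞)
    (hh : act h b ≠ ∞) (hne : act g b ≠ act h b) :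
    ∀ᶠ p in F, act g (p.2 : ℝ) ≠ act h (p.2 : ℝ) := by
  obtain ⟨r, hr⟩ := OnePoint.ne_infty_iff_exists.1 hg
  obtain ⟨s, hs⟩ := OnePoint.ne_infty_iff_exists.1 hh
  obtain ⟨f, hf, hf'⟩ := eventually_act_eq hF hr.symm
  obtain ⟨k, hk, hk'⟩ := eventually_act_eq hF hs.symm
  have hrs : r ≠ s := fun e => hne (by rw [← hr, ← hs, e])
  filter_upwards [hf', hk', (hf.sub hk).eventually_ne (sub_ne_zero.2 hrs)] with p h1 h2 h3
  rw [h1, h2]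
  exact fun e => h3 (sub_eq_zero.2 (OnePoint.coe_injective e))

theorem tendsto_fst_snd (hF : F ≤ nhds (a, b)) :
    Filter.Tendsto (fun p : ℝ × ℝ => p.1) F (nhds a) ∧
      Filter.Tendsto (fun p : ℝ × ℝ => p.2) F (nhds b) :=
  ⟨(continuous_fst.tendsto (a, b)).mono_left hF, (continuous_snd.tendsto (a, b)).mono_left hF⟩

theorem eventually_lt_iff {g : ℝ × ℝ → ℝ} {s : ℝ} (hf : Filter.Tendsto f F (nhds r))
    (hg : Filter.Tendsto g F (nhds s)) (h : r ≠ s) :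
    ∀ᶠ p in F, (f p < g p ↔ r < s) ∧ (f p ≤ g p ↔ r ≤ s) := by
  rcases lt_or_gt_of_ne h with h | h
  · filter_upwards [hf.eventually_lt hg h] with p hp
    simp [hp, hp.le, h, h.le]
  · filter_upwards [hg.eventually_lt hf h] with p hp
    exact ⟨iff_of_false hp.not_gt h.not_gt, iff_of_false hp.not_ge h.not_ge⟩

theorem eventually_rhoUpper_eq (hF : F ≤ nhds (a, b)) (hf : Filter.Tendsto f F (nhds r))
    (ha : r ≠ a) (hb : r ≠ b) :
    ∀ᶠ p in F, rhoUpper p.1 p.2 (f p : ℝ) = rhoUpper a b (r : ℝ) := by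
  filter_upwards [eventually_lt_iff hf (tendsto_fst_snd hF).1 ha,
    eventually_lt_iff hf (tendsto_fst_snd hF).2 hb] with p h1 h2
  simp [h1, h2]

theorem eventually_rhoLower_eq (hF : F ≤ nhds (a, b)) (hf : Filter.Tendsto f F (nhds r))
    (ha : r ≠ a) (hb : r ≠ b) :
    ∀ᶠ p in F, rhoLower p.1 p.2 (f p : ℝ) = rhoLower a b (r : ℝ) := by
  filter_upwards [eventually_lt_iff hf (tendsto_fst_snd hF).1 ha,
    eventually_lt_iff hf (tendsto_fst_snd hF).2 hb] with p h1 h2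
  simp [h1, h2]

theorem rhoUpper_upper_zero (hP : (a, b) ∈ parameterSet) :
    rhoUpper a b (upper a b 0) = S := by
  have h1 : 1 ≤ b - a := hP.2.2.1
  rw [upper_zero, rhoUpper_coe, if_neg (by linarith), if_pos (by linarith)]

theorem rhoLower_lower_zero (hP : (a, b) ∈ parameterSet) (hb : 0 < b) :
    rhoLower a b (lower a b 0) = T := by
  rw [lower_zero a hb, rhoLower_coe, if_pos (neg_inv_le_of_mem hP hb)]

/-- The word of the upper orbit is locally constant in the parameters as long as the orbit does
not hit a discontinuity after its start. -/
theorem eventually_upperWord_eq (hF : F ≤ nhds (a, b)) (hFP : ∀ᶠ p in F, p ∈ parameterSet)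
    (hP : (a, b) ∈ parameterSet) {m : ℕ} (h1 : ∀ i < m, upper a b i ≠ ∞)
    (h2 : ∀ i < m, upper a b i ≠ b) (h3 : ∀ i < m, upper a b i = a → i = 0) :
    ∀ᶠ p in F, ∀ i ≤ m, upperWord p.1 p.2 i = upperWord a b i := by
  induction m with
  | zero =>
    refine Filter.Eventually.of_forall fun p i hi => ?_
    rw [Nat.le_zero.1 hi, upperWord_zero, upperWord_zero]
  | succ m ih =>
    have ih := ih (fun i hi => h1 i (by omega)) (fun i hi => h2 i (by omega))
      (fun i hi => h3 i (by omega))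
    have key : ∀ᶠ p in F, rhoUpper p.1 p.2 (upper p.1 p.2 m) = rhoUpper a b (upper a b m) := by
      by_cases hm : m = 0
      · subst hm
        filter_upwards [hFP] with p hp
        rw [rhoUpper_upper_zero hP, rhoUpper_upper_zero hp]
      · obtain ⟨r, hr⟩ := OnePoint.ne_infty_iff_exists.1 (h1 m m.lt_succ_self)
        have hr' := hr
        rw [upper_eq_act] at hr'
        obtain ⟨f, hf, hf'⟩ := eventually_act_eq hF hr'.symm
        have hra : r ≠ a := fun e => hm (h3 m m.lt_succ_self (by rw [← hr, e]))
        have hrb : r ≠ b := fun e => h2 m m.lt_succ_self (by rw [← hr, e])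
        filter_upwards [ih, hf', eventually_rhoUpper_eq hF hf hra hrb] with p k1 k2 k3
        rw [upper_eq_act p.1, k1 m le_rfl, k2, k3, hr]
    filter_upwards [ih, key] with p k1 k2 i hi
    rcases Nat.le_succ_iff.1 hi with hi | rfl
    · exact k1 i hi
    · rw [upperWord_succ, upperWord_succ, k1 m le_rfl, k2]

/-- The word of the lower orbit is locally constant in the parameters as long as the orbit does
not hit a discontinuity, except perhaps for hits of `a` after which the rule for `a` persists. -/
theorem eventually_lowerWord_eq (hF : F ≤ nhds (a, b)) {k : ℕ}
    (h1 : ∀ j < k, lower a b j ≠ ∞) (h2 : ∀ j < k, lower a b j ≠ b)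
    (h3 : ∀ j < k, lower a b j = a → ∀ᶠ p in F, rhoLower p.1 p.2 (lower p.1 p.2 j) = T) :
    ∀ᶠ p in F, ∀ j ≤ k, lowerWord p.1 p.2 j = lowerWord a b j := by
  induction k with
  | zero =>
    refine Filter.Eventually.of_forall fun p j hj => ?_
    rw [Nat.le_zero.1 hj, lowerWord_zero, lowerWord_zero]
  | succ k ih =>
    have ih := ih (fun i hi => h1 i (by omega)) (fun i hi => h2 i (by omega))
      (fun i hi => h3 i (by omega))
    have key : ∀ᶠ p in F, rhoLower p.1 p.2 (lower p.1 p.2 k) = rhoLower a b (lower a b k) := by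
      by_cases hka : lower a b k = a
      · filter_upwards [h3 k k.lt_succ_self hka] with p hp
        rw [hp, hka, rhoLower_coe, if_pos le_rfl]
      · obtain ⟨r, hr⟩ := OnePoint.ne_infty_iff_exists.1 (h1 k k.lt_succ_self)
        have hr' := hr
        rw [lower_eq_act] at hr'
        obtain ⟨f, hf, hf'⟩ := eventually_act_eq hF hr'.symm
        have hra : r ≠ a := fun e => hka (by rw [← hr, e])
        have hrb : r ≠ b := fun e => h2 k k.lt_succ_self (by rw [← hr, e])
        filter_upwards [ih, hf', eventually_rhoLower_eq hF hf hra hrb] with p k1 k2 k3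
        rw [lower_eq_act p.1, k1 k le_rfl, k2, k3, hr]
    filter_upwards [ih, key] with p k1 k2 i hi
    rcases Nat.le_succ_iff.1 hi with hi | rfl
    · exact k1 i hi
    · rw [lowerWord_succ, lowerWord_succ, k1 k le_rfl, k2]

/-- If nearby orbits follow fixed words that agree at the end, and the points that these words
give at the centre are distinct before, then nearby parameters have the strong cycle property. -/
theorem eventually_strongCycleB_of_words (hF : F ≤ nhds (a, b)) {m k : ℕ} {g h : ℕ → SL(2, ℤ)}
    (hg : ∀ᶠ p in F, ∀ i ≤ m, upperWord p.1 p.2 i = g i)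
    (hh : ∀ᶠ p in F, ∀ j ≤ k, lowerWord p.1 p.2 j = h j)
    (hgh : ∀ z, act (g m) z = act (h k) z)
    (hg0 : ∀ i ≤ m, act (g i) b ≠ ∞) (hh0 : ∀ j ≤ k, act (h j) b ≠ ∞)
    (hne : ∀ i ≤ m, ∀ j ≤ k, act (g i) b = act (h j) b → i = m ∧ j = k) :
    ∀ᶠ p in F, StrongCycleB p.1 p.2 := by
  have key : ∀ᶠ p in F, ∀ i ∈ Set.Iic m, ∀ j ∈ Set.Iic k,
      act (g i) (p.2 : ℝ) = act (h j) (p.2 : ℝ) → i = m ∧ j = k := by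
    rw [Filter.eventually_all_finite (Set.finite_Iic m)]
    intro i hi
    rw [Filter.eventually_all_finite (Set.finite_Iic k)]
    intro j hj
    by_cases e : act (g i) b = act (h j) b
    · exact Filter.Eventually.of_forall fun p _ => hne i hi j hj e
    · filter_upwards [eventually_act_ne_act hF (hg0 i hi) (hh0 j hj) e] with p hp
      exact fun e => absurd e hp
  filter_upwards [hg, hh, key] with p k1 k2 k3
  refine strongCycleB_iff.2 ⟨m, k, ⟨?_, fun i hi j hj e => ?_⟩, fun z => ?_⟩
  · rw [upper_eq_act, lower_eq_act, k1 m le_rfl, k2 k le_rfl, hgh]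
  · rw [upper_eq_act, lower_eq_act, k1 i hi, k2 j hj] at e
    exact k3 i hi j hj e
  · rw [k1 m le_rfl, k2 k le_rfl, hgh]

end Stability

/-! ### Openness of the strong cycle property -/

theorem eq_zero_of_step_eq_infty {ρ : OnePoint ℝ → SL(2, ℤ)} {z : OnePoint ℝ}
    (hρ : ρ z = T ∨ ρ z = S ∨ ρ z = T⁻¹) (hz : z ≠ ∞) (h : step ρ z = ∞) :
    z = ((0 : ℝ) : OnePoint ℝ) := by
  obtain ⟨x, rfl⟩ := OnePoint.ne_infty_iff_exists.1 hz
  by_contra h0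
  have h0 : x ≠ 0 := fun e => h0 (by rw [e])
  rw [step] at h
  rcases hρ with e | e | e <;> rw [e] at h
  · simp at h
  · simp [act_S_coe h0] at h
  · simp at h

theorem rhoUpper_cases (a b : ℝ) (z : OnePoint ℝ) :
    rhoUpper a b z = T ∨ rhoUpper a b z = S ∨ rhoUpper a b z = T⁻¹ := by
  induction z using OnePoint.rec with
  | infty => exact Or.inr (Or.inr rfl)
  | coe x => rw [rhoUpper_coe]; split_ifs <;> simp

theorem rhoLower_cases (a b : ℝ) (z : OnePoint ℝ) :
    rhoLower a b z = T ∨ rhoLower a b z = S ∨ rhoLower a b z = T⁻¹ := by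
  induction z using OnePoint.rec with
  | infty => exact Or.inr (Or.inr rfl)
  | coe x => rw [rhoLower_coe]; split_ifs <;> simp

/-- The two orbits do not meet first at `∞`: the only way to `∞` is through `0`. -/
theorem IsFirstMeeting.upper_last_ne_infty (hb : 0 < b) {m k : ℕ}
    (h : IsFirstMeeting (upper a b) (lower a b) m k) : upper a b m ≠ ∞ := by
  intro e
  have e' : lower a b k = ∞ := h.1.symm.trans e
  rcases m with _ | m
  · rw [upper_zero] at e
    exact OnePoint.coe_ne_infty _ e
  rcases k with _ | k
  · rw [lower_zero a hb] at e'
    exact OnePoint.coe_ne_infty _ e'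
  rw [upper_succ] at e
  rw [lower_succ] at e'
  have h1 := eq_zero_of_step_eq_infty (rhoUpper_cases a b _) (h.upper_ne_infty m.lt_succ_self) e
  have h2 := eq_zero_of_step_eq_infty (rhoLower_cases a b _) (h.lower_ne_infty k.lt_succ_self) e'
  have := (h.2 m m.le_succ k k.le_succ (h1.trans h2.symm)).1
  omega

theorem IsFirstMeeting.upper_ne_right (hab : a < b) {l : ℕ → OnePoint ℝ} {m k i : ℕ}
    (h : IsFirstMeeting (upper a b) l m k) (hi : i < m) : upper a b i ≠ b := fun e =>
  h.left_injOn upper_succ i.succ_pos hi (upper_succ_of_eq hab.le e).symm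

theorem IsFirstMeeting.lower_ne_right (hab : a < b) {u : ℕ → OnePoint ℝ} {m k j : ℕ}
    (h : IsFirstMeeting u (lower a b) m k) (hj : j < k) : lower a b j ≠ b := fun e =>
  h.right_injOn lower_succ j.succ_pos hj (lower_succ_of_eq hab e).symm

/-- The strong cycle property persists along a filter of nearby parameters if the upper orbit does
not hit `a` after its start, and if the rule at the hits of `a` by the lower orbit persists. -/
theorem eventually_strongCycleB_of_persistent (hP : (a, b) ∈ parameterSet) (hb : 0 < b)
    {F : Filter (ℝ × ℝ)} (hF : F ≤ nhds (a, b)) (hFP : ∀ᶠ p in F, p ∈ parameterSet) {m k : ℕ}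
    (hfm : IsFirstMeeting (upper a b) (lower a b) m k)
    (hw : ∀ z, act (upperWord a b m) z = act (lowerWord a b k) z)
    (hu : ∀ i < m, upper a b i = a → i = 0)
    (hl : ∀ j < k, lower a b j = a → ∀ᶠ p in F, rhoLower p.1 p.2 (lower p.1 p.2 j) = T) :
    ∀ᶠ p in F, StrongCycleB p.1 p.2 := by
  have hab := lt_of_mem hP
  refine eventually_strongCycleB_of_words hF
    (eventually_upperWord_eq hF hFP hP (fun i hi => hfm.upper_ne_infty hi)
      (fun i hi => hfm.upper_ne_right hab hi) hu)
    (eventually_lowerWord_eq hF (fun j hj => hfm.lower_ne_infty hj)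
      (fun j hj => hfm.lower_ne_right hab hj) hl) hw ?_ ?_ ?_
  · intro i hi
    rw [← upper_eq_act]
    rcases hi.lt_or_eq with hi | rfl
    exacts [hfm.upper_ne_infty hi, hfm.upper_last_ne_infty hb]
  · intro j hj
    rw [← lower_eq_act]
    rcases hj.lt_or_eq with hj | rfl
    exacts [hfm.lower_ne_infty hj, hfm.1 ▸ hfm.upper_last_ne_infty hb]
  · intro i hi j hj e
    rw [← upper_eq_act, ← lower_eq_act] at e
    exact hfm.2 i hi j hj e

/-- Let a synchronized lower point equal `a`, and let it exceed `a` along a filter of nearby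
parameters. There it enters the gap, and the orbits meet right away at `-1 / x`. -/
theorem eventually_strongCycleB_of_enters_gap (hP : (a, b) ∈ parameterSet) (hb : 0 < b)
    {F : Filter (ℝ × ℝ)} (hF : F ≤ nhds (a, b)) (hFP : ∀ᶠ p in F, p ∈ parameterSet)
    (hab : 1 < b - a) {n : ℕ} (hn : IsOutside a b (n + 1)) (hna : syncPoint a b n = a)
    (hu : ∀ i < (syncIndex a b n).1 + 2, upper a b i ≠ upper a b ((syncIndex a b n).1 + 2))
    (hl : ∀ j < (syncIndex a b n).2, lower a b j = a → j = 0)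
    (hgap : ∀ᶠ p in F, rhoLower p.1 p.2 (lower p.1 p.2 (syncIndex a b n).2) ≠ T) :
    ∀ᶠ p in F, StrongCycleB p.1 p.2 := by
  have hlt := lt_of_mem hP
  have hs := (hn.mono n.le_succ).isSync hP hb
  have ha := hn.neg hP hb n.succ_pos
  have hi1 : (syncIndex a b (n + 1)).1 = (syncIndex a b n).1 + 3 := by
    rw [syncIndex_succ_of_le hna.le]
  have hi2 : (syncIndex a b (n + 1)).2 = (syncIndex a b n).2 + 1 := by
    rw [syncIndex_succ_of_le hna.le]
  set P := (syncIndex a b n).1 with hPdef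
  set Q := (syncIndex a b n).2 with hQdef
  have hx : syncPoint a b n < 0 := hna.trans_lt ha
  have hup : ∀ i ≤ P + 2, ∃ r : ℝ, upper a b i = r := fun i hi => by
    obtain ⟨r, hr, -⟩ := hn.upper_mem hP hb (i := i) (by omega)
    exact ⟨r, hr⟩
  have hlo : ∀ j ≤ Q, ∃ r : ℝ, lower a b j = r := fun j hj => by
    obtain ⟨r, hr, -⟩ := hn.lower_mem hP hb (j := j) (by omega)
    exact ⟨r, hr⟩
  have hub : ∀ i < P + 2, upper a b i ≠ b := by
    -- A hit of `b` would lead the upper orbit back to its start before the index `P + 2`.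
    intro i hi e
    have e1 := eq_add_of_eq upper_succ (upper_succ_of_eq hlt.le e) (P + 2 - (i + 1))
    rw [show i + 1 + (P + 2 - (i + 1)) = P + 2 by omega] at e1
    exact hu _ (by omega) e1.symm
  have hlb : ∀ j < Q, lower a b j ≠ b := by
    intro j hj e
    obtain ⟨r, hr, -, hr2, -⟩ := hn.lower_mem hP hb (j := j) (by omega)
    have hrb : r = b := OnePoint.coe_injective (hr.symm.trans e)
    rcases hr2 with h | h <;> linarith [h]
  have hQ : lower a b Q = a := by rw [hs.lower_eq, hna]
  have hlow := eventually_lowerWord_eq (k := Q) hF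
    (fun j hj => by obtain ⟨r, hr⟩ := hlo j hj.le; rw [hr]; exact OnePoint.coe_ne_infty _) hlb
    (fun j hj e => by
      rw [hl j hj e]
      filter_upwards [hFP, (tendsto_fst_snd hF).2.eventually (lt_mem_nhds hb)] with p h1 h2
      exact rhoLower_lower_zero h1 h2)
  have hrule : ∀ᶠ p in F, rhoLower p.1 p.2 (lower p.1 p.2 Q) = S := by
    have hQ' := hQ
    rw [lower_eq_act] at hQ'
    obtain ⟨f, hf, hf'⟩ := eventually_act_eq hF hQ'
    filter_upwards [hlow, hf', hgap, hf.eventually_lt (tendsto_fst_snd hF).2 hlt]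
      with p h1 h2 h3 h4
    rw [lower_eq_act p.1, h1 Q le_rfl, h2, rhoLower_coe] at h3 ⊢
    split_ifs at h3 with h5
    · exact absurd rfl h3
    · rw [if_neg h5, if_pos h4.le]
    · rw [if_neg h5, if_pos h4.le]
  set h : ℕ → SL(2, ℤ) := fun j => if j ≤ Q then lowerWord a b j else S * lowerWord a b Q with hh
  have hend : act (S * lowerWord a b Q) b = upper a b (P + 2) := by
    rw [act_mul, ← lower_eq_act, hs.lower_eq, act_S_coe hx.ne, hs.upper_add_two_of_neg hP hb hx]
  refine eventually_strongCycleB_of_words hF (m := P + 2) (k := Q + 1) (h := h)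
    (eventually_upperWord_eq hF hFP hP ?_ hub ?_) ?_ ?_ ?_ ?_ ?_
  · intro i hi
    obtain ⟨r, hr⟩ := hup i hi.le
    rw [hr]
    exact OnePoint.coe_ne_infty _
  · intro i hi e
    by_contra h0
    have e1 := eq_add_of_eq upper_succ (hn.upper_eq_left hP hb (by omega) e) (P + 2 - i)
    rw [show i + (P + 2 - i) = P + 2 by omega] at e1
    exact hu _ (by omega) e1.symm
  · filter_upwards [hlow, hrule] with p h1 h2 j hj
    rcases Nat.le_succ_iff.1 hj with hj | rfl
    · rw [h1 j hj, hh]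
      simp only [if_pos hj]
    · rw [lowerWord_succ, h1 Q le_rfl, h2, hh]
      simp
  · intro z
    have : h (Q + 1) = S * lowerWord a b Q := by simp [hh]
    rw [this, act_mul, hs.word_eq, hs.upperWord_add_two_of_neg hP hb hx, act_STST]
    simp only [act_mul]
  · intro i hi
    obtain ⟨r, hr⟩ := hup i hi
    rw [← upper_eq_act, hr]
    exact OnePoint.coe_ne_infty _
  · intro j hj
    rcases Nat.le_succ_iff.1 hj with hj | rfl
    · obtain ⟨r, hr⟩ := hlo j hj
      rw [hh]
      simp only [if_pos hj]
      rw [← lower_eq_act, hr]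
      exact OnePoint.coe_ne_infty _
    · obtain ⟨r, hr⟩ := hup (P + 2) le_rfl
      have : h (Q + 1) = S * lowerWord a b Q := by simp [hh]
      rw [this, hend, hr]
      exact OnePoint.coe_ne_infty _
  · intro i hi j hj e
    rw [← upper_eq_act] at e
    rcases Nat.le_succ_iff.1 hj with hj | rfl
    · exfalso
      have : h j = lowerWord a b j := by simp [hh, hj]
      rw [this, ← lower_eq_act] at e
      exact hn.upper_ne_lower hP hb hab (by omega) (by omega) e
    · have : h (Q + 1) = S * lowerWord a b Q := by simp [hh]
      rw [this, hend] at e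
      rcases hi.lt_or_eq with hi | rfl
      · exact absurd e (hu i hi)
      · exact ⟨rfl, rfl⟩

/-- The strong cycle property persists near a parameter if, before the orbits meet, the upper orbit
does not hit `a` after its start, and the lower orbit does so only at a synchronized point: nearby,
that point is either moved by `T` as before, or it enters the gap, where the orbits meet earlier. -/
theorem eventually_strongCycleB_of_isFirstMeeting (hP : (a, b) ∈ parameterSet) (hb : 0 < b)
    {m k : ℕ} (hfm : IsFirstMeeting (upper a b) (lower a b) m k)
    (hw : ∀ z, act (upperWord a b m) z = act (lowerWord a b k) z)
    (hu : ∀ i < m, upper a b i = a → i = 0)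
    (hl : ∀ j < k, lower a b j = a → j = 0 ∨ ∃ n, j = (syncIndex a b n).2 ∧ syncPoint a b n = a ∧
      IsOutside a b (n + 1) ∧
      ∀ i < (syncIndex a b n).1 + 2, upper a b i ≠ upper a b ((syncIndex a b n).1 + 2)) :
    ∀ᶠ p in nhdsWithin (a, b) parameterSet, StrongCycleB p.1 p.2 := by
  have hF : nhdsWithin (a, b) parameterSet ≤ nhds (a, b) := nhdsWithin_le_nhds
  have hFP : ∀ᶠ p in nhdsWithin (a, b) parameterSet, p ∈ parameterSet :=
    eventually_mem_nhdsWithin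
  have hzero : ∀ᶠ p in nhdsWithin (a, b) parameterSet,
      rhoLower p.1 p.2 (lower p.1 p.2 0) = T := by
    filter_upwards [hFP, (tendsto_fst_snd hF).2.eventually (lt_mem_nhds hb)] with p h1 h2
    exact rhoLower_lower_zero h1 h2
  by_cases hex : ∃ j < k, j ≠ 0 ∧ lower a b j = a
  swap
  · refine eventually_strongCycleB_of_persistent hP hb hF hFP hfm hw hu fun j hj e => ?_
    by_cases h0 : j = 0
    · rwa [h0]
    · exact absurd ⟨j, hj, h0, e⟩ hex
  obtain ⟨j, hj, hj0, hja⟩ := hex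
  obtain ⟨n, rfl, hna, hout, hne⟩ := (hl j hj hja).resolve_left hj0
  have huniq : ∀ j < k, lower a b j = a → j = (syncIndex a b n).2 := by
    intro j' hj' e
    by_contra hne
    rcases lt_or_gt_of_ne hne with h | h
    · exact hfm.right_injOn lower_succ h hj.le (e.trans hja.symm)
    · exact hfm.right_injOn lower_succ h hj'.le (hja.trans e.symm)
  have hab : 1 < b - a := by
    refine lt_of_le_of_ne hP.2.2.1 fun e => ?_
    have e0 : upper a b 0 = a := by
      rw [upper_zero]
      congr 1
      linarith
    have := (hfm.2 0 m.zero_le _ hj.le (e0.trans hja.symm)).2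
    omega
  set Z : Set (ℝ × ℝ) := {p | rhoLower p.1 p.2 (lower p.1 p.2 (syncIndex a b n).2) = T} with hZ
  have h1 : ∀ᶠ p in nhdsWithin (a, b) parameterSet ⊓ Filter.principal Z,
      StrongCycleB p.1 p.2 := by
    refine eventually_strongCycleB_of_persistent hP hb (inf_le_left.trans hF)
      (hFP.filter_mono inf_le_left) hfm hw hu fun j' hj' e => ?_
    rw [huniq j' hj' e]
    exact Filter.mem_inf_of_right (Filter.mem_principal_self Z)
  have h2 : ∀ᶠ p in nhdsWithin (a, b) parameterSet ⊓ Filter.principal Zᶜ,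
      StrongCycleB p.1 p.2 := by
    refine eventually_strongCycleB_of_enters_gap hP hb (inf_le_left.trans hF)
      (hFP.filter_mono inf_le_left) hab hout hna hne (fun j' hj' e => ?_)
      (Filter.mem_inf_of_right (Filter.mem_principal_self Zᶜ))
    exact absurd (huniq j' (hj'.trans hj) e) hj'.ne
  rw [Filter.eventually_inf_principal] at h1 h2
  filter_upwards [h1, h2] with p k1 k2
  by_cases hp : p ∈ Z
  exacts [k1 hp, k2 hp]

theorem not_strongCycleB_zero (hP : (a, 0) ∈ parameterSet) : ¬ StrongCycleB a 0 := by
  intro h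
  obtain ⟨m, k, hfm, -⟩ := strongCycleB_iff.1 h
  have hl : lower a 0 0 = ∞ := act_S_zero
  rcases k with _ | k
  swap
  · exact hfm.lower_ne_infty k.succ_pos hl
  have hm := hfm.1.trans hl
  rcases m with _ | m
  · rw [upper_zero] at hm
    exact OnePoint.coe_ne_infty _ hm
  have h0 := eq_zero_of_step_eq_infty (rhoUpper_cases a 0 _) (hfm.upper_ne_infty m.lt_succ_self)
    (by rwa [← upper_succ])
  rw [upper_step_T_inv h0 hP.1 le_rfl] at hm
  exact OnePoint.coe_ne_infty _ hm

/-- If a synchronized point before the gap equals `a`, then the upper orbit reaches `-1/a` two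
steps later, at an index at which the point is new. -/
theorem IsOutside.upper_ne_of_gap (hP : (a, b) ∈ parameterSet) (hb : 0 < b) {N n : ℕ}
    (h : IsOutside a b N) (ha : a < syncPoint a b N) (hxb : syncPoint a b N < b / (b + 1))
    (hn : n < N) (hna : syncPoint a b n = a) :
    ∀ i < (syncIndex a b n).1 + 2, upper a b i ≠ upper a b ((syncIndex a b n).1 + 2) := by
  intro i hi e
  have hlt := fst_syncIndex_add_two_lt hna.le hn
  have e := eq_add_of_eq upper_succ e ((syncIndex a b N).1 - ((syncIndex a b n).1 + 2))
  rw [Nat.add_sub_cancel' hlt.le] at e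
  exact h.upper_ne_upper hP hb ha hxb (by omega) e

/-- The strong cycle property persists if the orbits pass through a corner. If the given first
meeting lies beyond the corner on one of the orbits, and that orbit hits `a` there, then the corner
itself is a first meeting, and the orbits up to the corner do not hit `a` after their start. -/
theorem IsCorner.eventually_strongCycleB (hP : (a, b) ∈ parameterSet) (hb : 0 < b) {N M K : ℕ}
    (hc : IsCorner a b N M K) (hN : IsOutside a b N) (ha : a < syncPoint a b N)
    (hxb : syncPoint a b N < b / (b + 1)) {m k : ℕ}
    (hfm : IsFirstMeeting (upper a b) (lower a b) m k)
    (hw : ∀ z, act (upperWord a b m) z = act (lowerWord a b k) z) :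
    ∀ᶠ p in nhdsWithin (a, b) parameterSet, StrongCycleB p.1 p.2 := by
  have hab := lt_of_mem hP
  have hagree : ∀ z ∉ ({(a : OnePoint ℝ), (b : OnePoint ℝ)} : Set (OnePoint ℝ)),
      step (rhoUpper a b) z = step (rhoLower a b) z := fun z hz =>
    step_rhoUpper_eq_step_rhoLower (fun e => hz (Or.inl e)) (fun e => hz (Or.inr e))
  have hsync : ∀ j, (∃ n < N, j = (syncIndex a b n).2 ∧ syncPoint a b n = a) →
      ∃ n, j = (syncIndex a b n).2 ∧ syncPoint a b n = a ∧ IsOutside a b (n + 1) ∧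
      ∀ i < (syncIndex a b n).1 + 2, upper a b i ≠ upper a b ((syncIndex a b n).1 + 2) := by
    rintro j ⟨n, hn, hj, hna⟩
    exact ⟨n, hj, hna, hN.mono hn, hN.upper_ne_of_gap hP hb ha hxb hn hna⟩
  have hcorner : IsFirstMeeting (upper a b) (lower a b) M K →
      (∀ n < N, syncPoint a b n ≠ a) →
      ∀ᶠ p in nhdsWithin (a, b) parameterSet, StrongCycleB p.1 p.2 := by
    intro hfm' hna
    refine eventually_strongCycleB_of_isFirstMeeting hP hb hfm' hc.word_eq
      (fun i hi e => hc.eq_zero_of_upper_eq_left hi e) fun j hj e => ?_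
    rcases hc.lower_eq_left j hj e with h0 | ⟨n, hn, -, h⟩
    exacts [Or.inl h0, absurd h (hna n hn)]
  have hgood : (∀ i, M ≤ i → i < m → upper a b i ≠ a) → (∀ j, K ≤ j → j < k → lower a b j ≠ a) →
      ∀ᶠ p in nhdsWithin (a, b) parameterSet, StrongCycleB p.1 p.2 := by
    intro h1 h2
    refine eventually_strongCycleB_of_isFirstMeeting hP hb hfm hw (fun i hi e => ?_)
      fun j hj e => ?_
    · rcases lt_or_ge i M with h | h
      exacts [hc.eq_zero_of_upper_eq_left h e, absurd e (h1 i h hi)]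
    · rcases lt_or_ge j K with h | h
      exacts [(hc.lower_eq_left j h e).imp_right (hsync j), absurd e (h2 j h hj)]
  by_cases hu : ∃ i, M ≤ i ∧ i < m ∧ upper a b i = a
  · obtain ⟨i, hMi, him, e⟩ := hu
    have hk : k < K := by
      by_contra hk
      have := (hfm.2 M (by omega) K (by omega) hc.meet).1
      omega
    have hna : ∀ n < N, syncPoint a b n ≠ a := by
      -- Otherwise the upper orbit would be at `-1/a` twice before the index `m`.
      intro n hn hna
      have ha0 := hN.neg hP hb (Nat.zero_lt_of_lt hn)
      have h1 := ((hN.mono hn.le).isSync hP hb).upper_add_two_of_neg hP hb (hna.trans_lt ha0)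
      have h2 := upper_step_S e le_rfl hab ha0.ne
      have h3 := fst_syncIndex_add_two_lt hna.le hn
      have h4 := hc.fst_lt
      rw [hna] at h1
      exact hfm.left_injOn upper_succ (show _ < i + 1 by omega) him (h1.trans h2.symm)
    refine hcorner (IsFirstMeeting.of_lt_of_lt hagree upper_succ lower_succ hc.meet hc.apart
      hc.lower_new (fun j hj hjK hmem => ?_) hfm (by omega) hk) hna
    rcases hmem with e | e
    · rcases hc.lower_eq_left j hjK e with h0 | ⟨n, hn, -, h⟩
      exacts [by omega, hna n hn h]
    · exact hc.lower_ne hab hjK e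
  by_cases hl : ∃ j, K ≤ j ∧ j < k ∧ lower a b j = a
  · obtain ⟨j, hKj, hjk, e⟩ := hl
    have hm : m < M := by
      by_contra hm
      have := (hfm.2 M (by omega) K (by omega) hc.meet).2
      omega
    have hna : ∀ n < N, syncPoint a b n ≠ a := by
      intro n hn hna
      have h1 := ((hN.mono hn.le).isSync hP hb).lower_eq
      have h2 : (syncIndex a b n).2 < (syncIndex a b N).2 := strictMono_snd_syncIndex hn
      have h3 := hc.snd_lt
      rw [hna] at h1
      exact hfm.right_injOn lower_succ (show _ < j by omega) hjk.le (h1.trans e.symm)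
    refine hcorner (IsFirstMeeting.of_lt_of_lt (fun z hz => (hagree z hz).symm) lower_succ
      upper_succ hc.meet.symm hc.apart.symm hc.upper_new (fun i hi hiM hmem => ?_) hfm.symm
      (by omega) hm).symm hna
    rcases hmem with e | e
    · have := hc.eq_zero_of_upper_eq_left hiM e
      omega
    · exact hc.upper_ne hab hiM e
  · exact hgood (fun i h1 h2 e => hu ⟨i, h1, h2, e⟩) fun j h1 h2 e => hl ⟨j, h1, h2, e⟩

/-- The strong cycle property of `b` persists near every parameter that has it. -/
theorem eventually_strongCycleB (hP : (a, b) ∈ parameterSet) (h : StrongCycleB a b) :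
    ∀ᶠ p in nhdsWithin (a, b) parameterSet, StrongCycleB p.1 p.2 := by
  have hb : 0 < b := by
    refine lt_of_le_of_ne hP.2.1 ?_
    rintro rfl
    exact not_strongCycleB_zero hP h
  have hab := lt_of_mem hP
  obtain ⟨m, k, hfm, hw⟩ := strongCycleB_iff.1 h
  -- If the first meeting lies within the range of synchronized pairs outside the gap, the
  -- location of the orbits gives all that is needed.
  have hstart : ∀ n, IsOutside a b n → m ≤ (syncIndex a b n).1 →
      ∀ i < m, upper a b i = a → i = 0 := by
    intro n hn hm i hi e
    by_contra h0
    exact hfm.left_injOn upper_succ (Nat.pos_of_ne_zero h0) hi.le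
      (hn.upper_eq_left hP hb (by omega) e).symm
  have hgap1 : ∀ j < k, j ≠ 0 → lower a b j = a → 1 < b - a := by
    intro j hj h0 e
    refine lt_of_le_of_ne hP.2.2.1 fun e1 => ?_
    have e0 : upper a b 0 = a := by
      rw [upper_zero]
      congr 1
      linarith
    have := (hfm.2 0 m.zero_le j hj.le (e0.trans e.symm)).2
    omega
  by_cases hall : ∀ n, IsOutside a b n
  · set n := m + k + 1 with hn
    have hm : n ≤ (syncIndex a b n).1 := strictMono_fst_syncIndex.id_le n
    have hk : n ≤ (syncIndex a b n).2 := strictMono_snd_syncIndex.id_le n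
    refine eventually_strongCycleB_of_isFirstMeeting hP hb hfm hw
      (hstart n (hall n) (by omega)) fun j hj e => ?_
    refine ((hall n).lower_eq_left hP hb (by omega) e).imp_right fun hN => ?_
    obtain ⟨N, -, hj', -⟩ := hN
    have h0 : j ≠ 0 := by have := snd_syncIndex_pos (a := a) (b := b) N; omega
    exact absurd hfm.1 ((hall n).upper_ne_lower hP hb (hgap1 j hj h0 e) (by omega) (by omega))
  push Not at hall
  obtain ⟨n, hn⟩ := hall
  obtain ⟨N, -, hN, h0 | ⟨h1, h2, h0⟩⟩ := exists_gap_of_not_isOutside hP.1 hn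
  · -- Both orbits reach `0` and stay at `∞` from then on.
    have eu := hN.upper_eq_zero hP hb h0
    have el := hN.lower_eq_zero hP hb h0
    have hu1 : upper a b ((syncIndex a b N).1 + 1) = ∞ := by
      rw [upper_eq_act, upperWord_step_S eu hP.1 hb, act_mul, ← upper_eq_act, eu, act_S_zero]
    have hbox : m ≤ (syncIndex a b N).1 ∧ k ≤ (syncIndex a b N).2 := by
      by_contra hbox
      rcases le_or_gt (syncIndex a b N).1 m with hm | hm
      · rcases le_or_gt (syncIndex a b N).2 k with hk | hk
        · have := hfm.2 _ hm _ hk (eu.trans el.symm)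
          omega
        · obtain ⟨r, hr, -⟩ := hN.lower_mem hP hb hk
          rcases hm.lt_or_eq with hm | hm
          · rcases (Nat.succ_le_of_lt hm).lt_or_eq with hm | hm
            · exact hfm.upper_ne_infty hm hu1
            · have e := hfm.1
              rw [← hm, Nat.succ_eq_add_one, hu1, hr] at e
              exact OnePoint.coe_ne_infty _ e.symm
          · omega
      · have hk : (syncIndex a b N).2 < k := by omega
        have ha : a < 0 := by
          refine hN.neg hP hb (Nat.pos_of_ne_zero ?_)
          rintro rfl
          exact absurd hm (Nat.not_lt_zero _)
        have hl1 : lower a b ((syncIndex a b N).2 + 1) = ∞ := by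
          rw [lower_eq_act, lowerWord_step_S el ha hb.le, act_mul, ← lower_eq_act, el, act_S_zero]
        obtain ⟨r, hr, -⟩ := hN.upper_mem hP hb hm
        rcases (Nat.succ_le_of_lt hk).lt_or_eq with hk | hk
        · exact hfm.lower_ne_infty hk hl1
        · have e := hfm.1
          rw [← hk, Nat.succ_eq_add_one, hl1, hr] at e
          exact OnePoint.coe_ne_infty _ e
    refine eventually_strongCycleB_of_isFirstMeeting hP hb hfm hw (hstart N hN hbox.1)
      fun j hj e => (hN.lower_eq_left hP hb (by omega) e).imp_right ?_
    rintro ⟨n, hn, hj, hna⟩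
    have ha := hN.neg hP hb (Nat.zero_lt_of_lt hn)
    exact ⟨n, hj, hna, hN.mono hn, hN.upper_ne_of_gap hP hb (by rwa [h0])
      (by rw [h0]; positivity) hn hna⟩
  · rcases lt_or_gt_of_ne h0 with h0 | h0
    · exact (hN.isCorner_of_neg hP hb h0 h1).eventually_strongCycleB hP hb hN h1 h2 hfm hw
    · exact (hN.isCorner_of_pos hP hb h0 h2).eventually_strongCycleB hP hb hN h1 h2 hfm hw

/-! ### The reflection that exchanges the cycles of `a` and `b` -/

/-- The reflection `x ↦ -x` of the projective line. -/
def reflect (x : OnePoint ℝ) : OnePoint ℝ := x.elim ∞ fun t : ℝ => ((-t : ℝ) : OnePoint ℝ)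

@[simp] theorem reflect_coe (x : ℝ) :
    reflect (x : OnePoint ℝ) = ((-x : ℝ) : OnePoint ℝ) := rfl

@[simp] theorem reflect_infty : reflect ∞ = ∞ := rfl

theorem reflect_reflect (x : OnePoint ℝ) : reflect (reflect x) = x := by
  induction x using OnePoint.rec with
  | infty => rfl
  | coe x => simp

theorem reflect_injective : Function.Injective reflect :=
  Function.LeftInverse.injective reflect_reflect

theorem reflect_act_T (x : OnePoint ℝ) : reflect (act T x) = act T⁻¹ (reflect x) := by
  induction x using OnePoint.rec with
  | infty => simp
  | coe x => simp [sub_eq_add_neg, add_comm]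

theorem reflect_act_T_inv (x : OnePoint ℝ) : reflect (act T⁻¹ x) = act T (reflect x) := by
  apply act_injective T⁻¹
  rw [← reflect_act_T, act_act_inv, act_inv_act]

theorem reflect_act_S (x : OnePoint ℝ) : reflect (act S x) = act S (reflect x) := by
  induction x using OnePoint.rec with
  | infty => simp
  | coe x =>
    by_cases hx : x = 0
    · simp [hx]
    · rw [act_S_coe hx, reflect_coe, reflect_coe, act_S_coe (neg_ne_zero.2 hx), inv_neg]

/-- The rule `ρ'` is the mirror image of the rule `ρ`. At the common fixed point `∞` the images of
the generators need not correspond. -/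
structure IsMirror (ρ ρ' : OnePoint ℝ → SL(2, ℤ)) : Prop where
  step_infty : step ρ ∞ = ∞
  step_infty' : step ρ' ∞ = ∞
  reflect_act : ∀ x ≠ ∞, ∀ z, reflect (act (ρ x) z) = act (ρ' (reflect x)) (reflect z)

theorem isMirror_rhoUpper (hab : a < b) : IsMirror (rhoUpper a b) (rhoLower (-b) (-a)) where
  step_infty := step_rhoUpper_infty _ _
  step_infty' := step_rhoLower_infty _ _
  reflect_act x hx z := by
    obtain ⟨x, rfl⟩ := OnePoint.ne_infty_iff_exists.1 hx
    rw [reflect_coe, rhoUpper_coe, rhoLower_coe]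
    rcases lt_or_ge x a with h1 | h1
    · rw [if_pos h1, if_neg (by linarith), if_neg (by linarith), reflect_act_T]
    · rcases lt_or_ge x b with h2 | h2
      · rw [if_neg (by linarith), if_pos h2, if_neg (by linarith), if_pos (by linarith),
          reflect_act_S]
      · rw [if_neg (by linarith), if_neg (by linarith), if_pos (by linarith), reflect_act_T_inv]

theorem isMirror_rhoLower (hab : a < b) : IsMirror (rhoLower a b) (rhoUpper (-b) (-a)) where
  step_infty := step_rhoLower_infty _ _
  step_infty' := step_rhoUpper_infty _ _
  reflect_act x hx z := by
    have hx' : reflect x ≠ ∞ := fun e => hx (reflect_injective e)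
    have h := (isMirror_rhoUpper (neg_lt_neg hab)).reflect_act _ hx' (reflect z)
    rw [reflect_reflect, reflect_reflect, neg_neg, neg_neg] at h
    rw [← h, reflect_reflect]

theorem IsMirror.reflect_orbit {ρ ρ' : OnePoint ℝ → SL(2, ℤ)} (h : IsMirror ρ ρ')
    (x : OnePoint ℝ) (n : ℕ) : reflect (orbit ρ x n) = orbit ρ' (reflect x) n := by
  induction n with
  | zero => rfl
  | succ n ih =>
    rw [orbit_succ, orbit_succ, ← ih]
    by_cases hx : orbit ρ x n = ∞
    · rw [hx, h.step_infty, reflect_infty, h.step_infty']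
    · exact h.reflect_act _ hx _

theorem IsMirror.reflect_act_word {ρ ρ' : OnePoint ℝ → SL(2, ℤ)} (h : IsMirror ρ ρ')
    {x : OnePoint ℝ} {n : ℕ} (hn : ∀ i < n, orbit ρ x i ≠ ∞) (z : OnePoint ℝ) :
    reflect (act (word ρ x n) z) = act (word ρ' (reflect x) n) (reflect z) := by
  induction n with
  | zero => simp only [word, act_one]
  | succ n ih =>
    rw [word, word, act_mul, act_mul, h.reflect_act _ (hn n n.lt_succ_self), h.reflect_orbit,
      ih fun i hi => hn i (by omega)]

theorem orbit_ne_infty {ρ : OnePoint ℝ → SL(2, ℤ)} (hρ : step ρ ∞ = ∞) {x : OnePoint ℝ}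
    {l : ℕ → OnePoint ℝ} {m k i : ℕ} (h : IsFirstMeeting (orbit ρ x) l m k) (hi : i < m) :
    orbit ρ x i ≠ ∞ := fun e =>
  h.left_injOn (orbit_succ ρ x) (Nat.lt_succ_self i) hi (by rw [orbit_succ, e, hρ])

theorem strongCycleA_iff : StrongCycleA a b ↔ ∃ m k,
    IsFirstMeeting (orbit (rhoUpper a b) (act S a)) (orbit (rhoLower a b) (act T a)) m k ∧
    ∀ z, act (word (rhoUpper a b) (act S a) m) (act S z) =
      act (word (rhoLower a b) (act T a) k) (act T z) := by
  refine exists_congr fun m => exists_congr fun k => and_congr_right fun _ => ?_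
  refine forall_congr' fun z => ?_
  rw [← mul_inv_rev, mul_assoc, act_mul, ← act_mul (word (rhoUpper a b) _ m),
    ← act_mul (word (rhoLower a b) _ k)]
  constructor <;> intro h
  · apply act_injective (word (rhoLower a b) (act T a) k * T)⁻¹
    rw [h, act_inv_act]
  · rw [h, act_inv_act]

/-- The reflection `x ↦ -x` takes the cycle of `a` for the parameters `(a, b)` to the cycle of `-a`
for the parameters `(-b, -a)`, with the roles of the upper and the lower orbit exchanged. -/
theorem strongCycleA_iff_strongCycleB (hab : a < b) :
    StrongCycleA a b ↔ StrongCycleB (-b) (-a) := by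
  rw [strongCycleA_iff, strongCycleB_iff, exists_comm]
  have hS : reflect (act S a) = act S ((-a : ℝ) : OnePoint ℝ) := reflect_act_S _
  have hT : reflect (act T a) = act T⁻¹ ((-a : ℝ) : OnePoint ℝ) := reflect_act_T _
  have hlow : ∀ n, lower (-b) (-a) n = reflect (orbit (rhoUpper a b) (act S a) n) := fun n => by
    rw [(isMirror_rhoUpper hab).reflect_orbit, hS, lower]
  have hupp : ∀ n, upper (-b) (-a) n = reflect (orbit (rhoLower a b) (act T a) n) := fun n => by
    rw [(isMirror_rhoLower hab).reflect_orbit, hT, upper]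
  refine exists_congr fun k => exists_congr fun m => ?_
  have hfm : IsFirstMeeting (upper (-b) (-a)) (lower (-b) (-a)) k m ↔
      IsFirstMeeting (orbit (rhoUpper a b) (act S a)) (orbit (rhoLower a b) (act T a)) m k := by
    have h1 : ∀ i j, upper (-b) (-a) i = lower (-b) (-a) j ↔
        orbit (rhoLower a b) (act T a) i = orbit (rhoUpper a b) (act S a) j := fun i j => by
      rw [hlow, hupp, reflect_injective.eq_iff]
    constructor <;> intro h
    · refine IsFirstMeeting.symm ⟨(h1 _ _).1 h.1, fun i hi j hj e => h.2 i hi j hj ((h1 _ _).2 e)⟩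
    · exact ⟨(h1 _ _).2 h.1.symm, fun i hi j hj e => h.symm.2 i hi j hj ((h1 _ _).1 e)⟩
  rw [hfm]
  refine and_congr_right fun h => ?_
  have hl : ∀ z, act (lowerWord (-b) (-a) m) (reflect z) =
      reflect (act (word (rhoUpper a b) (act S a) m) (act S z)) := fun z => by
    rw [(isMirror_rhoUpper hab).reflect_act_word
      (fun i hi => orbit_ne_infty (step_rhoUpper_infty a b) h hi), hS, reflect_act_S, lowerWord,
      act_mul]
  have hu : ∀ z, act (upperWord (-b) (-a) k) (reflect z) =
      reflect (act (word (rhoLower a b) (act T a) k) (act T z)) := fun z => by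
    rw [(isMirror_rhoLower hab).reflect_act_word
      (fun i hi => orbit_ne_infty (step_rhoLower_infty a b) h.symm hi), hT, reflect_act_T,
      upperWord, act_mul]
  constructor <;> intro hw z
  · rw [← reflect_reflect z, hl, hu, hw]
  · apply reflect_injective
    rw [← hl, ← hu, hw]

/-! ### Open and dense subsets of the parameter set -/

theorem isOpen_setOf_strongCycleB :
    IsOpen {p : parameterSet | StrongCycleB p.1.1 p.1.2} := by
  refine isOpen_iff_mem_nhds.2 fun p hp => ?_
  have h : Filter.Tendsto (Subtype.val : parameterSet → ℝ × ℝ) (nhds p)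
      (nhdsWithin p.1 parameterSet) :=
    tendsto_nhdsWithin_iff.2 ⟨continuous_subtype_val.tendsto p,
      Filter.Eventually.of_forall fun q => q.2⟩
  exact h.eventually (eventually_strongCycleB p.2 hp)

/-- Near every point of the parameter set there is a vertical segment in it, over some `a < 0`. -/
theorem exists_segment (hP : (a, b) ∈ parameterSet) {r : ℝ} (hr : 0 < r) :
    ∃ a' b₁ b₂ : ℝ, a' < 0 ∧ b₁ < b₂ ∧ |a' - a| < r ∧
      ∀ c ∈ Set.Icc b₁ b₂, 0 < c ∧ |c - b| < r ∧ (a', c) ∈ parameterSet := by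
  obtain ⟨ha, hb, h1, h2⟩ := hP
  simp only at ha hb h1 h2
  rcases h2.lt_or_eq with h2 | h2
  · have hC : 0 < 2 * -a + b + 2 := by linarith
    set ε := min (min (r / 3) 1) ((1 + a * b) / (2 * -a + b + 2)) with hε
    have e0 : 0 < ε := lt_min (lt_min (by linarith) one_pos) (div_pos (by linarith) hC)
    have e1 : ε ≤ r / 3 := (min_le_left _ _).trans (min_le_left _ _)
    have e2 : ε ≤ 1 := (min_le_left _ _).trans (min_le_right _ _)
    have e3 : ε * (2 * -a + b + 2) ≤ 1 + a * b := (le_div_iff₀ hC).1 (min_le_right _ _)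
    refine ⟨a - ε, b + ε, b + 2 * ε, by linarith, by linarith, ?_, fun c hc => ?_⟩
    · rw [abs_lt]
      constructor <;> linarith
    · obtain ⟨c1, c2⟩ := hc
      refine ⟨by linarith, by rw [abs_lt]; constructor <;> linarith, ?_, ?_, ?_, ?_⟩
      · simp only; linarith
      · simp only; linarith
      · simp only; linarith
      · simp only
        have h3 : (-a + ε) * c ≤ (-a + ε) * (b + 2 * ε) :=
          mul_le_mul_of_nonneg_left c2 (by linarith)
        nlinarith
  · -- On the boundary curve `-ab = 1` one has `b - a ≥ 2`, and `b` can be decreased.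
    have hb0 : 0 < b := lt_of_le_of_ne hb (by rintro rfl; simp at h2)
    have ha0 : a < 0 := lt_of_le_of_ne ha (by rintro rfl; simp at h2)
    have hba : 2 ≤ b - a := by nlinarith [sq_nonneg (b + a)]
    set ε := min (r / 3) (min (b / 3) (1 / 3)) with hε
    have e0 : 0 < ε := lt_min (by linarith) (lt_min (by linarith) (by norm_num))
    have e1 : ε ≤ r / 3 := min_le_left _ _
    have e2 : ε ≤ b / 3 := (min_le_right _ _).trans (min_le_left _ _)
    have e3 : ε ≤ 1 / 3 := (min_le_right _ _).trans (min_le_right _ _)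
    refine ⟨a, b - 2 * ε, b - ε, ha0, by linarith, by simpa using hr, fun c hc => ?_⟩
    obtain ⟨c1, c2⟩ := hc
    refine ⟨by linarith, by rw [abs_lt]; constructor <;> linarith, ha, ?_, ?_, ?_⟩
    · simp only; linarith
    · simp only; linarith
    · simp only
      nlinarith

theorem dense_setOf_strongCycleB :
    Dense {p : parameterSet | StrongCycleB p.1.1 p.1.2} := by
  refine Metric.dense_iff.2 fun p r hr => ?_
  obtain ⟨⟨a, b⟩, hp⟩ := p
  obtain ⟨a', b₁, b₂, ha', h12, hr', h⟩ := exists_segment hp hr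
  obtain ⟨c, hc, hs⟩ := exists_strongCycleB ha' h12 (fun c hc => (h c hc).1)
    fun c hc => (h c hc).2.2
  refine ⟨⟨(a', c), (h c hc).2.2⟩, ?_, hs⟩
  rw [Metric.mem_ball, Subtype.dist_eq, Prod.dist_eq, max_lt_iff, Real.dist_eq, Real.dist_eq]
  exact ⟨hr', (h c hc).2.1⟩

/-- The reflection of the parameter set, `(a, b) ↦ (-b, -a)`. -/
def reflectParameter : parameterSet ≃ₜ parameterSet where
  toFun p := ⟨(-p.1.2, -p.1.1), neg_nonpos.2 p.2.2.1, neg_nonneg.2 p.2.1,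
    by have := p.2.2.2.1; simp only; linarith, by have := p.2.2.2.2; simp only; linarith⟩
  invFun p := ⟨(-p.1.2, -p.1.1), neg_nonpos.2 p.2.2.1, neg_nonneg.2 p.2.1,
    by have := p.2.2.2.1; simp only; linarith, by have := p.2.2.2.2; simp only; linarith⟩
  left_inv p := by simp
  right_inv p := by simp
  continuous_toFun := by fun_prop
  continuous_invFun := by fun_prop

theorem setOf_strongCycleA_eq : {p : parameterSet | StrongCycleA p.1.1 p.1.2} =
    reflectParameter ⁻¹' {p : parameterSet | StrongCycleB p.1.1 p.1.2} :=
  Set.ext fun p => strongCycleA_iff_strongCycleB (lt_of_mem p.2)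

theorem isOpen_setOf_strongCycleA :
    IsOpen {p : parameterSet | StrongCycleA p.1.1 p.1.2} := by
  rw [setOf_strongCycleA_eq]
  exact isOpen_setOf_strongCycleB.preimage reflectParameter.continuous

theorem dense_setOf_strongCycleA :
    Dense {p : parameterSet | StrongCycleA p.1.1 p.1.2} := by
  rw [setOf_strongCycleA_eq]
  exact dense_setOf_strongCycleB.preimage reflectParameter.isOpenMap

end ABContinuedFraction

theorem mainTheorem7 :
    IsOpen {p : ABContinuedFraction.parameterSet |
      ABContinuedFraction.StrongCycleA p.1.1 p.1.2 ∧
        ABContinuedFraction.StrongCycleB p.1.1 p.1.2} ∧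
    Dense {p : ABContinuedFraction.parameterSet |
      ABContinuedFraction.StrongCycleA p.1.1 p.1.2 ∧
        ABContinuedFraction.StrongCycleB p.1.1 p.1.2} :=
  ⟨ABContinuedFraction.isOpen_setOf_strongCycleA.inter
      ABContinuedFraction.isOpen_setOf_strongCycleB,
    ABContinuedFraction.dense_setOf_strongCycleA.inter_of_isOpen_left
      ABContinuedFraction.dense_setOf_strongCycleB
      ABContinuedFraction.isOpen_setOf_strongCycleA⟩
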